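/- All matroids have a finite ground set; $E$ is the ground set of the matroid, $\operatorname{rk}$ its rank function and $k=\operatorname{rk}(E)$. A matroid is uniform if, for some $j$, its bases are all the $j$-element subsets of its ground set (empty matroid included), and connected if it is not a direct sum of two non-empty matroids. A subset $A\subseteq E$ is stressed if the restriction $M|_A$ and the contraction $M/A$ are both uniform. Its cusp is $\operatorname{cusp}_M(A)=\{S\subseteq E: |S|=k,\ |S\cap A|\ge \operatorname{rk}(A)+1\}$. For a stressed subset $A$, the relaxation $\operatorname{Rel}(M,A)$ is the matroid on $E$ whose bases are those of $M$ together with the members of $\operatorname{cusp}_M(A)$. A cyclic flat is a flat that is a union of circuits; the cyclic flats form a lattice $\mathcal Z(M)$ under inclusion. A flacet is a flat $F$ with $M|_F$ and $M/F$ connected; it is a split flacet if $0<\operatorname{rk}(F)<|F|$ and $E\smallsetminus F$ contains an element that is not a coloop. A matroid is elementary split if it is either a connected matroid all of whose split flacets are stressed, or a direct sum of two uniform matroids. **Theorem 3.12.** Let $M$ be a matroid on $E$. 1. Every stressed subset of $M$ with non-empty cusp is a cyclic flat. 2. Relaxing all the stressed subsets of $M$ with non-empty cusp, one after another in any order, is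 possible, and the result does not depend on the order: it is the matroid $\widetilde M$ on $E$ whose bases are those of $M$ together with the members of the cusps in $M$ of all these subsets. The matroid $M$ is elementary split if and only if $\widetilde M$ is uniform. 3. Suppose that $M$ has no loops and no coloops. Then each relaxation in this process deletes one cyclic flat: if $N$ is obtained from $M$ by successively relaxing some of the stressed subsets of $M$ with non-empty cusp, and $A$ is another such subset of $M$, then $A$ covers $\varnothing$ and is covered by $E$ in $\mathcal Z(N)$, the relaxation $\operatorname{Rel}(N,A)$ exists, $\mathcal Z(\operatorname{Rel}(N,A))=\mathcal Z(N)\smallsetminus\{A\}$, and the ranks of the remaining cyclic flats do not change. -/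

import Mathlib

open scoped Matroid

namespace Matroid

variable {α : Type*}

/-- A uniform matroid: for some natural number `k`, the bases are exactly the `k`-element subsets
of the ground set. -/
def IsUniform (M : Matroid α) : Prop :=
  ∃ k : ℕ, ∀ B : Set α, M.IsBase B ↔ B ⊆ M.E ∧ B.encard = k

/-- A connected matroid: one that is not a direct sum of two non-empty matroids. -/
def IsConnected (M : Matroid α) : Prop :=
  ¬ ∃ (M₁ M₂ : Matroid α) (h : Disjoint M₁.E M₂.E),
    M₁.E.Nonempty ∧ M₂.E.Nonempty ∧ M = M₁.disjointSum M₂ h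

/-- A stressed subset: both the restriction to it and its contraction are uniform. -/
def IsStressed (M : Matroid α) (A : Set α) : Prop :=
  A ⊆ M.E ∧ (M ↾ A).IsUniform ∧ (M ／ A).IsUniform

/-- The cusp of `A`: the subsets `S` of the ground set with `|S| = rk M` and
`|S ∩ A| ≥ rk A + 1`. -/
def cusp (M : Matroid α) (A : Set α) : Set (Set α) :=
  {S | S ⊆ M.E ∧ S.encard = M.eRank ∧ M.eRk A + 1 ≤ (S ∩ A).encard}

/-- A stressed subset with non-empty cusp. -/
def IsStressedCuspidal (M : Matroid α) (A : Set α) : Prop :=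
  M.IsStressed A ∧ (M.cusp A).Nonempty

/-- `N` is the relaxation of `M` by the stressed subset `A`: it has the same ground set, and its
bases are those of `M` together with the members of the cusp of `A`. -/
def IsRelaxation (M : Matroid α) (A : Set α) (N : Matroid α) : Prop :=
  M.IsStressed A ∧ N.E = M.E ∧ ∀ B : Set α, N.IsBase B ↔ M.IsBase B ∨ B ∈ M.cusp A

/-- `RelaxesTo M l N`: relaxing the members of the list `l` one after another, each of them being
stressed in the matroid reached so far, leads from `M` to `N`. -/
inductive RelaxesTo : Matroid α → List (Set α) → Matroid α → Prop
  | nil (M : Matroid α) : RelaxesTo M [] M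
  | cons {M N P : Matroid α} {A : Set α} {l : List (Set α)} :
      IsRelaxation M A N → RelaxesTo N l P → RelaxesTo M (A :: l) P

/-- A cyclic flat: a flat that is a union of circuits. -/
def IsCyclicFlat (M : Matroid α) (F : Set α) : Prop :=
  M.IsFlat F ∧ ∃ 𝒞 : Set (Set α), (∀ C ∈ 𝒞, M.IsCircuit C) ∧ F = ⋃₀ 𝒞

/-- The collection of cyclic flats, ordered by inclusion. -/
def cyclicFlats (M : Matroid α) : Set (Set α) := {F | M.IsCyclicFlat F}

/-- `X` and `Y` are cyclic flats of `M`, and `Y` covers `X` in the poset of cyclic flats. -/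
def CyclicFlatCovBy (M : Matroid α) (X Y : Set α) : Prop :=
  ∃ (hX : X ∈ M.cyclicFlats) (hY : Y ∈ M.cyclicFlats),
    (⟨X, hX⟩ : M.cyclicFlats) ⋖ (⟨Y, hY⟩ : M.cyclicFlats)

/-- A flacet: a flat whose restriction and contraction are connected. -/
def IsFlacet (M : Matroid α) (F : Set α) : Prop :=
  M.IsFlat F ∧ (M ↾ F).IsConnected ∧ (M ／ F).IsConnected

/-- A split flacet: a flacet `F` with `0 < rk F < |F|` whose complement contains an element that
is not a coloop. -/
def IsSplitFlacet (M : Matroid α) (F : Set α) : Prop :=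
  M.IsFlacet F ∧ 0 < M.eRk F ∧ M.eRk F < F.encard ∧ ∃ e ∈ M.E \ F, ¬ M.IsColoop e

/-- A connected split matroid: a connected matroid all of whose split flacets are stressed. -/
def IsConnectedSplit (M : Matroid α) : Prop :=
  M.IsConnected ∧ ∀ F : Set α, M.IsSplitFlacet F → M.IsStressed F

/-- An elementary split matroid: a connected split matroid or a direct sum of two uniform
matroids. -/
def IsElementarySplit (M : Matroid α) : Prop :=
  M.IsConnectedSplit ∨ ∃ (M₁ M₂ : Matroid α) (h : Disjoint M₁.E M₂.E),
    M₁.IsUniform ∧ M₂.IsUniform ∧ M = M₁.disjointSum M₂ h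

end Matroid

/-! Write k = rk E. A stressed subset A with non-empty cusp amounts to rank formulas
(`isStressedCuspidal_iff_rk`): rk X = min(|X|, rk A) for X ⊆ A, rk X = min(rk A + |X \ A|, k) for X
⊇ A, and rk A < |A|, rk A < k. Relaxing A raises the rank of X to min(|X|, k) when |X ∩ A| > rk A
and leaves it alone otherwise (`IsRelaxation.rk_eq`).

Relaxations do not interfere because distinct such A, B satisfy |A ∩ B| + k ≤ rk A + rk B
(`ncard_inter_add_le`). Thus |A ∩ B| < rk A, so relaxing A changes no rank inside B; B stays
stressed with the same cusp. Induction along a list (`exists_relaxesTo`) then gives a set of bases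
that does not depend on the order.

Uniformity of the final matroid and elementary splitness of M are both equivalent to one condition:
every non-spanning circuit is contained in, and spans, a stressed subset with non-empty cusp
(`forall_isBase_or_mem_cusp_iff`, `isElementarySplit_iff`). In a connected matroid such a circuit
lies in a maximal connected non-spanning set, which is a split flacet. In a disconnected one, every
stressed subset with non-empty cusp is a separator.

For cyclic flats, uniformity of M|A and M/A leaves no cyclic flat strictly between ∅ and A or
between A and E. The rank formula for the relaxation then shows that only A is lost. -/

namespace Matroid

/-! ### Natural-number rank in a finite matroid. -/

section Rank

variable {α : Type*} {M : Matroid α} {A B C D F I S X Y : Set α} {e : α}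

/-- The rank of a set as a natural number (zero if the rank is infinite). -/
noncomputable def rk (M : Matroid α) (X : Set α) : ℕ := (M.eRk X).toNat

lemma coe_rk (M : Matroid α) [M.Finite] (X : Set α) : (M.rk X : ℕ∞) = M.eRk X :=
  ENat.natCast_toNat (eRk_ne_top_iff.2 (M.isRkFinite_set X))

lemma rk_mono (M : Matroid α) [M.Finite] (h : X ⊆ Y) : M.rk X ≤ M.rk Y := by
  rw [← Nat.cast_le (α := ℕ∞), coe_rk, coe_rk]
  exact M.eRk_mono h

lemma rk_submod (M : Matroid α) [M.Finite] (X Y : Set α) :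
    M.rk (X ∩ Y) + M.rk (X ∪ Y) ≤ M.rk X + M.rk Y := by
  rw [← Nat.cast_le (α := ℕ∞)]
  push_cast
  simp only [coe_rk]
  exact M.eRk_submod X Y

lemma rk_empty (M : Matroid α) : M.rk ∅ = 0 := by simp [rk]

lemma rk_union_le (M : Matroid α) [M.Finite] (X Y : Set α) :
    M.rk (X ∪ Y) ≤ M.rk X + M.rk Y := by
  have := M.rk_submod X Y
  omega

lemma rk_le_ncard (M : Matroid α) [M.Finite] (hX : X ⊆ M.E) : M.rk X ≤ X.ncard := by
  rw [← Nat.cast_le (α := ℕ∞), coe_rk, (M.set_finite X hX).cast_ncard_eq]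
  exact M.eRk_le_encard X

lemma rk_singleton_le (M : Matroid α) [M.Finite] (e : α) : M.rk {e} ≤ 1 := by
  rw [← Nat.cast_le (α := ℕ∞), coe_rk]
  exact (M.eRk_le_encard {e}).trans (by simp)

lemma rk_insert_le (M : Matroid α) [M.Finite] (e : α) (X : Set α) :
    M.rk (insert e X) ≤ M.rk X + 1 := by
  rw [← Set.union_singleton]
  have := M.rk_union_le X {e}
  have := M.rk_singleton_le e
  omega

lemma rk_eq_eRank (M : Matroid α) [M.Finite] : (M.rk M.E : ℕ∞) = M.eRank := by
  rw [coe_rk, eRk_ground]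

lemma ncard_inter_add_ncard_sdiff (M : Matroid α) [M.Finite] (hX : X ⊆ M.E) (A : Set α) :
    (X ∩ A).ncard + (X \ A).ncard = X.ncard := by
  have h := Set.ncard_union_eq (Set.disjoint_sdiff_inter (s := X) (t := A)).symm
    (M.set_finite _ (Set.inter_subset_left.trans hX)) (M.set_finite _ (Set.sdiff_subset.trans hX))
  rw [Set.inter_union_sdiff] at h
  exact h.symm

lemma indep_iff_rk [M.Finite] : M.Indep I ↔ I ⊆ M.E ∧ M.rk I = I.ncard := by
  constructor
  · intro h
    refine ⟨h.subset_ground, ?_⟩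
    rw [← Nat.cast_inj (R := ℕ∞), coe_rk, (M.set_finite I h.subset_ground).cast_ncard_eq,
      h.eRk_eq_encard]
  · rintro ⟨hI, h⟩
    rw [← Nat.cast_inj (R := ℕ∞), coe_rk, (M.set_finite I hI).cast_ncard_eq] at h
    obtain ⟨J, hJ⟩ := M.exists_isBasis I
    have := (M.set_finite J (hJ.subset.trans hI)).eq_of_subset_of_encard_le hJ.subset
      (by rw [hJ.encard_eq_eRk, h])
    exact this ▸ hJ.indep

lemma exists_indep_rk [M.Finite] (hX : X ⊆ M.E) :
    ∃ I ⊆ X, M.Indep I ∧ I.ncard = M.rk X := by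
  obtain ⟨I, hI⟩ := M.exists_isBasis X
  refine ⟨I, hI.subset, hI.indep, ?_⟩
  rw [← (indep_iff_rk.1 hI.indep).2, ← Nat.cast_inj (R := ℕ∞), coe_rk, coe_rk, hI.eRk_eq_eRk]

lemma isBase_iff_rk [M.Finite] :
    M.IsBase B ↔ B ⊆ M.E ∧ B.ncard = M.rk M.E ∧ M.rk B = M.rk M.E := by
  constructor
  · intro h
    have hi := indep_iff_rk.1 h.indep
    have : M.rk B = M.rk M.E := by
      rw [← Nat.cast_inj (R := ℕ∞), coe_rk, coe_rk, h.eRk_eq_eRank, eRk_ground]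
    exact ⟨hi.1, by omega, this⟩
  · rintro ⟨hB, hc, hr⟩
    have hi : M.Indep B := indep_iff_rk.2 ⟨hB, by omega⟩
    obtain ⟨B', hB', hBB'⟩ := hi.exists_isBase_superset
    have h1 := indep_iff_rk.1 hB'.indep
    have h2 := M.rk_mono h1.1
    have := Set.eq_of_subset_of_ncard_le hBB' (by omega) (M.set_finite B' h1.1)
    exact this ▸ hB'

lemma rk_restrict (M : Matroid α) (h : X ⊆ A) : (M ↾ A).rk X = M.rk X := by
  rw [rk, rk, restrict_eRk_eq _ h]

/-- A basis I of A extends to a basis J of X ∪ A, and J \ I is a basis of X in the contraction. The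
additive form avoids truncated subtraction. -/
lemma rk_contract_add (M : Matroid α) [M.Finite] (hA : A ⊆ M.E) (hX : X ⊆ M.E \ A) :
    (M ／ A).rk X + M.rk A = M.rk (X ∪ A) := by
  obtain ⟨I, hI⟩ := M.exists_isBasis A
  have hXA : X ∪ A ⊆ M.E := Set.union_subset (hX.trans Set.sdiff_subset) hA
  obtain ⟨J, hJ, hIJ⟩ :=
    hI.indep.subset_isBasis_of_subset (hI.subset.trans (Set.subset_union_right (s := X))) hXA
  have hJA : J ∩ A = I := (hI.eq_of_subset_indep (hJ.indep.inter_right A)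
    (Set.subset_inter hIJ hI.subset) Set.inter_subset_right).symm
  have hdisj : Disjoint X A := Set.disjoint_of_subset_left hX Set.disjoint_sdiff_left
  have hb := hJ.contract_isBasis hI
    (hJ.indep.subset (Set.union_subset Set.sdiff_subset hIJ))
  rw [Set.union_sdiff_cancel_right (Set.disjoint_iff.1 hdisj)] at hb
  have h1 := hb.encard_eq_eRk
  have h2 := hI.encard_eq_eRk
  have h3 := hJ.encard_eq_eRk
  rw [← Nat.cast_inj (R := ℕ∞)]
  push_cast
  rw [coe_rk, coe_rk, coe_rk, ← h1, ← h2, ← h3, ← hJA, Set.encard_sdiff_add_encard_inter]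

end Rank

/-! ### Uniformity, cusps, cyclic flats, circuits and connectedness in terms of rank. -/

section Characterizations

variable {α : Type*} {M : Matroid α} {A B C D F I S X Y : Set α} {e : α}

lemma isUniform_iff_rk [M.Finite] :
    M.IsUniform ↔ ∀ X ⊆ M.E, M.rk X = min X.ncard (M.rk M.E) := by
  constructor
  · rintro ⟨k, hk⟩ X hX
    have hk' : ∀ B ⊆ M.E, B.ncard = k → M.IsBase B := fun B hB h ↦ (hk B).2
      ⟨hB, by rw [← h, (M.set_finite B hB).cast_ncard_eq]⟩
    obtain ⟨B₀, hB₀⟩ := M.exists_isBase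
    have hkr : k = M.rk M.E := by
      have := ((hk B₀).1 hB₀).2
      rw [← (M.set_finite B₀ hB₀.subset_ground).cast_ncard_eq, Nat.cast_inj] at this
      rw [← this, (isBase_iff_rk.1 hB₀).2.1]
    have hkE := M.rk_le_ncard (subset_refl M.E)
    rcases le_total X.ncard k with h | h
    · obtain ⟨B, hXB, hBE, hB⟩ := Set.exists_subsuperset_card_eq hX h (by omega)
      have := indep_iff_rk.1 ((hk' B hBE hB).indep.subset hXB)
      omega
    · obtain ⟨B, hBX, hB⟩ := Set.exists_subset_card_eq h
      have h1 := isBase_iff_rk.1 (hk' B (hBX.trans hX) hB)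
      have := M.rk_mono hBX
      have := M.rk_mono hX
      omega
  · intro h
    refine ⟨M.rk M.E, fun B ↦ ?_⟩
    rw [isBase_iff_rk]
    refine and_congr_right fun hB ↦ ?_
    rw [← (M.set_finite B hB).cast_ncard_eq, Nat.cast_inj, h B hB]
    omega

lemma isUniform_restrict_iff_rk [M.Finite] (hA : A ⊆ M.E) :
    (M ↾ A).IsUniform ↔ ∀ X ⊆ A, M.rk X = min X.ncard (M.rk A) := by
  have : (M ↾ A).Finite := ⟨M.set_finite A hA⟩
  rw [isUniform_iff_rk, restrict_ground_eq, rk_restrict _ subset_rfl]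
  refine forall₂_congr fun X hX ↦ ?_
  rw [rk_restrict _ hX]

lemma isUniform_contract_iff_rk [M.Finite] (hA : A ⊆ M.E) :
    (M ／ A).IsUniform ↔
      ∀ X ⊆ M.E, A ⊆ X → M.rk X = min (M.rk A + (X \ A).ncard) (M.rk M.E) := by
  rw [isUniform_iff_rk, contract_ground]
  have hE := M.rk_contract_add hA subset_rfl
  rw [Set.sdiff_union_of_subset hA] at hE
  constructor
  · intro h X hX hAX
    have h1 := M.rk_contract_add hA (Set.sdiff_subset_sdiff_left hX)
    rw [Set.sdiff_union_of_subset hAX] at h1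
    have := h (X \ A) (Set.sdiff_subset_sdiff_left hX)
    omega
  · intro h X hX
    have h1 := M.rk_contract_add hA hX
    have h2 := h (X ∪ A) (Set.union_subset (hX.trans Set.sdiff_subset) hA) Set.subset_union_right
    have hd : (X ∪ A) \ A = X := Set.union_sdiff_cancel_right
      (Set.disjoint_iff.1 (Set.disjoint_of_subset_left hX Set.disjoint_sdiff_left))
    rw [hd] at h2
    omega

lemma mem_cusp_iff_rk [M.Finite] :
    S ∈ M.cusp A ↔ S ⊆ M.E ∧ S.ncard = M.rk M.E ∧ M.rk A < (S ∩ A).ncard := by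
  refine and_congr_right fun hS ↦ ?_
  rw [← (M.set_finite S hS).cast_ncard_eq, ← rk_eq_eRank, ← coe_rk,
    ← (M.set_finite _ (Set.inter_subset_left.trans hS)).cast_ncard_eq, Nat.cast_inj]
  refine and_congr_right fun _ ↦ ?_
  norm_cast

/-- The last two inequalities express that the cusp is non-empty: they are exactly what is needed to
choose rk A + 1 elements of A and enlarge them to a set of size rk M. -/
lemma isStressedCuspidal_iff_rk [M.Finite] :
    M.IsStressedCuspidal A ↔ A ⊆ M.E ∧ (∀ X ⊆ A, M.rk X = min X.ncard (M.rk A)) ∧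
      (∀ X ⊆ M.E, A ⊆ X → M.rk X = min (M.rk A + (X \ A).ncard) (M.rk M.E)) ∧
      M.rk A < A.ncard ∧ M.rk A < M.rk M.E := by
  rw [IsStressedCuspidal, IsStressed]
  constructor
  · rintro ⟨⟨hA, h1, h2⟩, S, hS⟩
    rw [mem_cusp_iff_rk] at hS
    have h3 := Set.ncard_le_ncard (Set.inter_subset_right (s := S)) (M.set_finite A hA)
    have h4 := Set.ncard_le_ncard (Set.inter_subset_left (t := A)) (M.set_finite S hS.1)
    exact ⟨hA, (isUniform_restrict_iff_rk hA).1 h1, (isUniform_contract_iff_rk hA).1 h2,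
      by omega, by omega⟩
  · rintro ⟨hA, h1, h2, h3, h4⟩
    refine ⟨⟨hA, (isUniform_restrict_iff_rk hA).2 h1, (isUniform_contract_iff_rk hA).2 h2⟩, ?_⟩
    obtain ⟨T, hTA, hT⟩ := Set.exists_subset_card_eq (s := A) (n := M.rk A + 1) (by omega)
    have := M.rk_le_ncard (subset_refl M.E)
    obtain ⟨S, hTS, hSE, hS⟩ :=
      Set.exists_subsuperset_card_eq (hTA.trans hA) (n := M.rk M.E) (by omega) (by omega)
    refine ⟨S, mem_cusp_iff_rk.2 ⟨hSE, hS, ?_⟩⟩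
    have := Set.ncard_le_ncard (Set.subset_inter hTS hTA)
      (M.set_finite _ (Set.inter_subset_left.trans hSE))
    omega

lemma IsStressedCuspidal.subset_ground (hA : M.IsStressedCuspidal A) : A ⊆ M.E := hA.1.1

lemma mem_closure_iff_rk [M.Finite] (he : e ∈ M.E) :
    e ∈ M.closure X ↔ M.rk (insert e X) = M.rk X := by
  constructor
  · intro h
    rw [rk, rk, ← eRk_insert_closure_eq, Set.insert_eq_of_mem h, eRk_closure_eq]
  · intro h
    by_contra hc
    have h1 := eRk_insert_eq_add_one (M := M) (X := X) ⟨he, hc⟩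
    rw [← coe_rk, ← coe_rk] at h1
    norm_cast at h1
    omega

lemma isFlat_iff_rk [M.Finite] :
    M.IsFlat F ↔ F ⊆ M.E ∧ ∀ e ∈ M.E, e ∉ F → M.rk F < M.rk (insert e F) := by
  constructor
  · intro h
    refine ⟨h.subset_ground, fun e he heF ↦ ?_⟩
    have h1 := mt (mem_closure_iff_rk (X := F) he).2 (by rwa [h.closure])
    have := M.rk_mono (Set.subset_insert e F)
    omega
  · rintro ⟨hF, h⟩
    rw [isFlat_iff_closure_eq]
    refine Set.Subset.antisymm (fun e he ↦ ?_) (M.subset_closure F hF)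
    by_contra heF
    have heE := M.closure_subset_ground F he
    have h1 := h e heE heF
    rw [(mem_closure_iff_rk heE).1 he] at h1
    omega

lemma isCyclicFlat_iff_rk [M.Finite] :
    M.IsCyclicFlat F ↔ F ⊆ M.E ∧ (∀ e ∈ M.E, e ∉ F → M.rk F < M.rk (insert e F)) ∧
      ∀ e ∈ F, M.rk (F \ {e}) = M.rk F := by
  rw [IsCyclicFlat, isFlat_iff_rk, and_assoc]
  refine and_congr_right fun hF ↦ and_congr_right fun _ ↦ ?_
  constructor
  · rintro ⟨𝒞, h𝒞, rfl⟩ e he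
    obtain ⟨C, hC, heC⟩ := Set.mem_sUnion.1 he
    have h1 : e ∈ M.closure (⋃₀ 𝒞 \ {e}) :=
      M.closure_subset_closure (Set.sdiff_subset_sdiff_left (Set.subset_sUnion_of_mem hC))
        ((h𝒞 C hC).mem_closure_sdiff_singleton_of_mem heC)
    rw [mem_closure_iff_rk (hF he), Set.insert_sdiff_singleton, Set.insert_eq_of_mem he] at h1
    exact h1.symm
  · intro h
    refine ⟨{C | M.IsCircuit C ∧ C ⊆ F}, fun C hC ↦ hC.1, ?_⟩
    refine Set.Subset.antisymm (fun e he ↦ ?_) (Set.sUnion_subset fun C hC ↦ hC.2)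
    have h1 : e ∈ M.closure (F \ {e}) := by
      rw [mem_closure_iff_rk (hF he), Set.insert_sdiff_singleton, Set.insert_eq_of_mem he]
      exact (h e he).symm
    obtain ⟨C, hCF, hC, heC⟩ := exists_isCircuit_of_mem_closure h1 (by simp)
    rw [Set.insert_sdiff_singleton, Set.insert_eq_of_mem he] at hCF
    exact Set.mem_sUnion.2 ⟨C, ⟨hC, hCF⟩, heC⟩

lemma isCircuit_rk [M.Finite] (hC : M.IsCircuit C) :
    C.ncard = M.rk C + 1 ∧ ∀ X ⊂ C, M.rk X = X.ncard := by
  have h2 : ∀ X ⊂ C, M.rk X = X.ncard := fun X hX ↦ (indep_iff_rk.1 (hC.ssubset_indep hX)).2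
  refine ⟨?_, h2⟩
  obtain ⟨e, he⟩ := hC.nonempty
  have h1 := h2 _ (Set.sdiff_singleton_ssubset.2 he)
  have h3 := Set.ncard_sdiff_singleton_add_one he (M.set_finite C hC.subset_ground)
  have h4 := M.rk_mono (Set.sdiff_subset : C \ {e} ⊆ C)
  have h5 := M.rk_le_ncard hC.subset_ground
  have h6 : M.rk C ≠ C.ncard := fun h ↦ hC.not_indep (indep_iff_rk.2 ⟨hC.subset_ground, h⟩)
  omega

lemma exists_isCircuit_of_rk_lt [M.Finite] (hX : X ⊆ M.E) (h : M.rk X < X.ncard) :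
    ∃ C ⊆ X, M.IsCircuit C := by
  refine Dep.exists_isCircuit_subset ((not_indep_iff hX).1 fun hi ↦ ?_)
  have := (indep_iff_rk.1 hi).2
  omega

/-- The rank is additive along a separator. -/
lemma rk_inter_add_rk_sdiff [M.Finite] {Z : Set α} (hX : X ⊆ Z)
    (h : M.rk X + M.rk (Z \ X) ≤ M.rk Z) (hY : Y ⊆ Z) :
    M.rk (Y ∩ X) + M.rk (Y \ X) = M.rk Y := by
  have h1 := M.rk_submod Y X
  have h2 := M.rk_submod (Y ∪ X) (Z \ X)
  have h3 : (Y ∪ X) ∩ (Z \ X) = Y \ X := by tauto_set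
  have h4 : (Y ∪ X) ∪ (Z \ X) = Z := by tauto_set
  rw [h3, h4] at h2
  have h5 := M.rk_union_le (Y ∩ X) (Y \ X)
  rw [Set.inter_union_sdiff] at h5
  omega

lemma disjointSum_restrict_left {M₁ M₂ : Matroid α} (h : Disjoint M₁.E M₂.E) :
    (M₁.disjointSum M₂ h) ↾ M₁.E = M₁ := by
  refine ext_indep rfl fun I hI ↦ ?_
  rw [restrict_ground_eq] at hI
  rw [restrict_indep_iff, disjointSum_indep_iff, Set.inter_eq_self_of_subset_left hI,
    Set.disjoint_iff_inter_eq_empty.1 (Set.disjoint_of_subset_left hI h)]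
  simp [hI, hI.trans Set.subset_union_left]

lemma disjointSum_restrict_right {M₁ M₂ : Matroid α} (h : Disjoint M₁.E M₂.E) :
    (M₁.disjointSum M₂ h) ↾ M₂.E = M₂ := by
  rw [disjointSum_comm, disjointSum_restrict_left]

lemma disjointSum_rk {M₁ M₂ : Matroid α} (h : Disjoint M₁.E M₂.E)
    [(M₁.disjointSum M₂ h).Finite] :
    (M₁.disjointSum M₂ h).rk M₁.E + (M₁.disjointSum M₂ h).rk M₂.E
      ≤ (M₁.disjointSum M₂ h).rk (M₁.disjointSum M₂ h).E := by
  set N := M₁.disjointSum M₂ h with hN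
  obtain ⟨I, hIX, hI, hIr⟩ := exists_indep_rk (M := N) (X := M₁.E) (by simp [hN])
  obtain ⟨J, hJX, hJ, hJr⟩ := exists_indep_rk (M := N) (X := M₂.E) (by simp [hN])
  have hdisj : Disjoint I J := Set.disjoint_of_subset hIX hJX h
  have hIJ : N.Indep (I ∪ J) := by
    rw [hN, disjointSum_indep_iff] at hI hJ ⊢
    have h1 : (I ∪ J) ∩ M₁.E = I ∩ M₁.E := by
      have := Set.disjoint_of_subset_left hJX h.symm
      rw [Set.union_inter_distrib_right, Set.disjoint_iff_inter_eq_empty.1 this, Set.union_empty]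
    have h2 : (I ∪ J) ∩ M₂.E = J ∩ M₂.E := by
      have := Set.disjoint_of_subset_left hIX h
      rw [Set.union_inter_distrib_right, Set.disjoint_iff_inter_eq_empty.1 this, Set.empty_union]
    rw [h1, h2]
    exact ⟨hI.1, hJ.2.1, Set.union_subset hI.2.2 hJ.2.2⟩
  rw [← hIr, ← hJr, ← Set.ncard_union_eq hdisj (N.set_finite I hI.subset_ground)
    (N.set_finite J hJ.subset_ground), ← (indep_iff_rk.1 hIJ).2]
  exact N.rk_mono hIJ.subset_ground

lemma disjoint_ground_restrict_compl (M : Matroid α) (X : Set α) :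
    Disjoint (M ↾ X).E (M ↾ (M.E \ X)).E := by
  simpa only [restrict_ground_eq] using Set.disjoint_sdiff_right

/-- Rank and cardinality both split along the separator, so a set is independent as soon as its two
pieces are. -/
lemma eq_disjointSum_of_rk [M.Finite] (hX : X ⊆ M.E)
    (h : M.rk X + M.rk (M.E \ X) ≤ M.rk M.E) :
    M = (M ↾ X).disjointSum (M ↾ (M.E \ X)) (M.disjoint_ground_restrict_compl X) := by
  refine ext_indep (by simp [Set.union_eq_self_of_subset_left hX]) fun I hI ↦ ?_
  have h1 : I ∩ (M.E \ X) = I \ X := by tauto_set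
  simp only [disjointSum_indep_iff, restrict_ground_eq, restrict_indep_iff, h1]
  constructor
  · intro h'
    refine ⟨⟨h'.inter_right X, Set.inter_subset_right⟩, ⟨h'.sdiff X, by tauto_set⟩, ?_⟩
    rwa [Set.union_sdiff_cancel hX]
  · rintro ⟨⟨ha, -⟩, ⟨hb, -⟩, -⟩
    have h2 := rk_inter_add_rk_sdiff hX h hI
    have h3 := M.ncard_inter_add_ncard_sdiff hI X
    exact indep_iff_rk.2 ⟨hI, by rw [← h2, (indep_iff_rk.1 ha).2, (indep_iff_rk.1 hb).2, h3]⟩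

lemma isConnected_iff_rk [M.Finite] :
    M.IsConnected ↔
      ∀ X ⊆ M.E, M.rk X + M.rk (M.E \ X) ≤ M.rk M.E → X = ∅ ∨ X = M.E := by
  constructor
  · intro h X hX hr
    by_contra! hc
    refine h ⟨_, _, _, hc.1, ?_, eq_disjointSum_of_rk hX hr⟩
    rw [restrict_ground_eq, Set.sdiff_nonempty]
    exact fun h' ↦ hc.2 (hX.antisymm h')
  · rintro h ⟨M₁, M₂, hd, h1, h2, rfl⟩
    have hE : (M₁.disjointSum M₂ hd).E \ M₁.E = M₂.E := by
      rw [disjointSum_ground_eq, Set.union_sdiff_cancel_left (Set.disjoint_iff.1 hd)]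
    rcases h M₁.E (by simp) (by rw [hE]; exact disjointSum_rk hd) with h' | h'
    · simp [h'] at h1
    · rw [h', Set.sdiff_self] at hE
      simp [← hE] at h2

lemma isConnected_restrict_iff_rk [M.Finite] (hF : F ⊆ M.E) :
    (M ↾ F).IsConnected ↔ ∀ X ⊆ F, M.rk X + M.rk (F \ X) ≤ M.rk F → X = ∅ ∨ X = F := by
  have : (M ↾ F).Finite := ⟨M.set_finite F hF⟩
  rw [isConnected_iff_rk, restrict_ground_eq, rk_restrict _ subset_rfl]
  refine forall₂_congr fun X hX ↦ ?_
  rw [rk_restrict _ hX, rk_restrict _ Set.sdiff_subset]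

lemma isConnected_contract_of_rk [M.Finite] (hF : F ⊆ M.E)
    (h : ∀ X ⊆ M.E \ F, M.rk (X ∪ F) + M.rk (M.E \ X) ≤ M.rk M.E + M.rk F →
      X = ∅ ∨ X = M.E \ F) : (M ／ F).IsConnected := by
  rw [isConnected_iff_rk, contract_ground]
  intro X hX hr
  refine h X hX ?_
  have h1 := M.rk_contract_add hF hX
  have h2 := M.rk_contract_add hF (Set.sdiff_subset : (M.E \ F) \ X ⊆ M.E \ F)
  have h3 := M.rk_contract_add hF subset_rfl
  have h4 : (M.E \ F) \ X ∪ F = M.E \ X := by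
    have := hF; tauto_set
  rw [Set.sdiff_union_of_subset hF] at h3
  rw [h4] at h2
  omega

lemma exists_disjointSum_isUniform_iff_rk [M.Finite] :
    (∃ (M₁ M₂ : Matroid α) (h : Disjoint M₁.E M₂.E),
      M₁.IsUniform ∧ M₂.IsUniform ∧ M = M₁.disjointSum M₂ h) ↔
    ∃ X ⊆ M.E, M.rk X + M.rk (M.E \ X) ≤ M.rk M.E ∧ (∀ Y ⊆ X, M.rk Y = min Y.ncard (M.rk X)) ∧
      ∀ Y ⊆ M.E \ X, M.rk Y = min Y.ncard (M.rk (M.E \ X)) := by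
  constructor
  · rintro ⟨M₁, M₂, hd, h1, h2, rfl⟩
    have hE : (M₁.disjointSum M₂ hd).E \ M₁.E = M₂.E := by
      rw [disjointSum_ground_eq, Set.union_sdiff_cancel_left (Set.disjoint_iff.1 hd)]
    refine ⟨M₁.E, by simp, ?_, ?_, ?_⟩
    · rw [hE]
      exact disjointSum_rk hd
    · rw [← isUniform_restrict_iff_rk (by simp), disjointSum_restrict_left]
      exact h1
    · rw [hE, ← isUniform_restrict_iff_rk (by simp), disjointSum_restrict_right]
      exact h2
  · rintro ⟨X, hX, h, h1, h2⟩
    exact ⟨_, _, _, (isUniform_restrict_iff_rk hX).2 h1,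
      (isUniform_restrict_iff_rk Set.sdiff_subset).2 h2, eq_disjointSum_of_rk hX h⟩

lemma isColoop_iff_rk [M.Finite] (he : e ∈ M.E) :
    M.IsColoop e ↔ M.rk (M.E \ {e}) < M.rk M.E := by
  have h1 : M.IsColoop e ↔ e ∉ M.closure (M.E \ {e}) := by
    refine ⟨fun h hc ↦ by simpa using h.mem_of_mem_closure hc, fun h ↦ ?_⟩
    rw [isColoop_iff_forall_notMem_isCircuit he]
    exact fun C hC heC ↦ h (M.closure_subset_closure
      (Set.sdiff_subset_sdiff_left hC.subset_ground) (hC.mem_closure_sdiff_singleton_of_mem heC))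
  rw [h1, mem_closure_iff_rk he, Set.insert_sdiff_singleton, Set.insert_eq_of_mem he]
  have := M.rk_mono (Set.sdiff_subset : M.E \ {e} ⊆ M.E)
  omega

end Characterizations

end Matroid

namespace Matroid

/-! ### Existence and rank function of a relaxation. -/

section Relaxation

variable {α : Type*} {M N P : Matroid α} {A B C D F I S X Y : Set α} {e : α}

/-- X ∩ A is independent in the uniform M|A and X \ A in the uniform M/A. This makes `RelaxedIndep`
closed under subsets: a subset of a new independent set that drops to at most rk A elements of A is
already independent in M. -/
lemma IsStressedCuspidal.rk_eq_ncard [M.Finite] (hA : M.IsStressedCuspidal A) (hX : X ⊆ M.E)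
    (h1 : (X ∩ A).ncard ≤ M.rk A) (h2 : M.rk A + (X \ A).ncard ≤ M.rk M.E) :
    M.rk X = X.ncard := by
  obtain ⟨hAE, hu, hc, -, -⟩ := isStressedCuspidal_iff_rk.1 hA
  have h3 := hu (X ∩ A) Set.inter_subset_right
  have h4 := hc (X ∪ A) (Set.union_subset hX hAE) Set.subset_union_right
  rw [Set.union_sdiff_right] at h4
  have := M.rk_submod X A
  have := M.ncard_inter_add_ncard_sdiff hX A
  have := M.rk_le_ncard hX
  omega

lemma ncard_insert_of_notMem_ground [M.Finite] (hI : I ⊆ M.E) (he : e ∉ I) :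
    (insert e I).ncard = I.ncard + 1 :=
  Set.ncard_insert_of_notMem he (M.set_finite I hI)

lemma ncard_mono_ground [M.Finite] (h : X ⊆ Y) (hY : Y ⊆ M.E) : X.ncard ≤ Y.ncard :=
  Set.ncard_le_ncard h (M.set_finite Y hY)

lemma rk_union_eq_of_forall_insert [M.Finite] (hI : I ⊆ M.E) (hY : Y ⊆ M.E)
    (h : ∀ e ∈ Y, M.rk (insert e I) = M.rk I) : M.rk (I ∪ Y) = M.rk I := by
  have h1 : I ∪ Y ⊆ M.closure I := Set.union_subset (M.subset_closure I hI)
    fun e he ↦ (mem_closure_iff_rk (hY he)).2 (h e he)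
  have h2 := M.rk_mono h1
  have h3 := M.rk_mono (Set.subset_union_left : I ⊆ I ∪ Y)
  have h4 : M.rk (M.closure I) = M.rk I := by rw [rk, rk, eRk_closure_eq]
  omega

/-- The independence predicate of the relaxation of `M` by `A`. -/
def RelaxedIndep (M : Matroid α) (A I : Set α) : Prop :=
  M.Indep I ∨ (I ⊆ M.E ∧ I.ncard ≤ M.rk M.E ∧ M.rk A < (I ∩ A).ncard)

lemma RelaxedIndep.subset_ground (h : M.RelaxedIndep A I) : I ⊆ M.E :=
  h.elim (fun h ↦ h.subset_ground) fun h ↦ h.1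

lemma RelaxedIndep.ncard_le [M.Finite] (h : M.RelaxedIndep A I) : I.ncard ≤ M.rk M.E := by
  rcases h with h | h
  · rw [← (indep_iff_rk.1 h).2]
    exact M.rk_mono h.subset_ground
  · exact h.2.1

lemma IsStressedCuspidal.relaxedIndep_subset [M.Finite] (hA : M.IsStressedCuspidal A)
    (hI : M.RelaxedIndep A I) (hX : X ⊆ I) : M.RelaxedIndep A X := by
  rcases hI with hI | ⟨hIE, hIk, hIA⟩
  · exact .inl (hI.subset hX)
  have hXI := ncard_mono_ground hX hIE
  rcases lt_or_ge (M.rk A) (X ∩ A).ncard with h | h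
  · exact .inr ⟨hX.trans hIE, by omega, h⟩
  · refine .inl (indep_iff_rk.2 ⟨hX.trans hIE, hA.rk_eq_ncard (hX.trans hIE) h ?_⟩)
    have := M.ncard_inter_add_ncard_sdiff hIE A
    have := ncard_mono_ground (M := M) (Set.sdiff_subset_sdiff_left hX : X \ A ⊆ I \ A)
      (Set.sdiff_subset.trans hIE)
    omega

lemma IsStressedCuspidal.relaxedIndep_augment [M.Finite] (hA : M.IsStressedCuspidal A)
    {J : Set α} (hI : M.RelaxedIndep A I) (hJ : M.RelaxedIndep A J) (hIJ : I.ncard < J.ncard) :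
    ∃ e ∈ J, e ∉ I ∧ M.RelaxedIndep A (insert e I) := by
  have hJk := hJ.ncard_le
  have hJE := hJ.subset_ground
  have hIE := hI.subset_ground
  obtain ⟨hAE, hu, hc, hr1, hr2⟩ := isStressedCuspidal_iff_rk.1 hA
  rcases hI with hI | ⟨-, hIk, hIA⟩
  · rcases hJ with hJ | ⟨-, -, hJA⟩
    · obtain ⟨e, he, h⟩ := hI.augment hJ (by
        rw [← (M.set_finite I hIE).cast_ncard_eq, ← (M.set_finite J hJE).cast_ncard_eq]
        exact_mod_cast hIJ)
      exact ⟨e, he.1, he.2, .inl h⟩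
    · by_contra! hcon
      -- If no element of J can be added, I spans J, hence also A, since J ∩ A has more than rk A
      -- elements of a uniform restriction. Then rk (I ∪ A) ≤ |I| < k forces |I ∩ A| = rk A, and any
      -- element of (J ∩ A) \ I lifts I above the threshold.
      have hIr := (indep_iff_rk.1 hI).2
      have h1 : M.rk (I ∪ J) = M.rk I := by
        refine rk_union_eq_of_forall_insert hIE hJE fun e he ↦ ?_
        by_cases heI : e ∈ I
        · rw [Set.insert_eq_of_mem heI]
        have hni : ¬ M.Indep (insert e I) := fun h ↦ hcon e he heI (.inl h)
        have hne : M.rk (insert e I) ≠ (insert e I).ncard := fun h ↦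
          hni (indep_iff_rk.2 ⟨Set.insert_subset (hJE he) hIE, h⟩)
        rw [ncard_insert_of_notMem_ground hIE heI] at hne
        have := M.rk_mono (Set.subset_insert e I)
        have := M.rk_insert_le e I
        omega
      have h2 := hu (J ∩ A) Set.inter_subset_right
      have h3 := M.rk_submod (I ∪ J) A
      have h4 := M.rk_mono (show J ∩ A ⊆ (I ∪ J) ∩ A by tauto_set)
      have h5 := M.rk_mono (show I ∪ A ⊆ I ∪ J ∪ A by tauto_set)
      have h6 := hc (I ∪ A) (Set.union_subset hIE hAE) Set.subset_union_right
      rw [Set.union_sdiff_right] at h6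
      have h7 := M.ncard_inter_add_ncard_sdiff hIE A
      have h8 := (indep_iff_rk.1 (hI.inter_right A)).2
      have h9 := M.rk_mono (Set.inter_subset_right : I ∩ A ⊆ A)
      obtain ⟨e, he, heI⟩ := Set.exists_mem_notMem_of_ncard_lt_ncard
        (s := I ∩ A) (t := J ∩ A) (by omega) (M.set_finite _ (Set.inter_subset_left.trans hIE))
      have heI' : e ∉ I := fun h ↦ heI ⟨h, he.2⟩
      refine hcon e he.1 heI' (.inr ⟨Set.insert_subset (hJE he.1) hIE, ?_, ?_⟩)
      · rw [ncard_insert_of_notMem_ground hIE heI']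
        omega
      · rw [Set.insert_inter_of_mem he.2,
          ncard_insert_of_notMem_ground (Set.inter_subset_left.trans hIE) heI]
        omega
  · obtain ⟨e, he, heI⟩ := Set.exists_mem_notMem_of_ncard_lt_ncard hIJ (M.set_finite I hIE)
    have hE := Set.insert_subset (hJE he) hIE
    refine ⟨e, he, heI, .inr ⟨hE, ?_, hIA.trans_le ?_⟩⟩
    · rw [ncard_insert_of_notMem_ground hIE heI]
      omega
    · exact ncard_mono_ground (Set.inter_subset_inter_left A (Set.subset_insert e I))
        (Set.inter_subset_left.trans hE)

lemma IsStressedCuspidal.exists_relaxedIndep [M.Finite] (hA : M.IsStressedCuspidal A) :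
    ∃ P : Matroid α, P.E = M.E ∧ ∀ I, P.Indep I ↔ M.RelaxedIndep A I :=
  ⟨(IndepMatroid.ofFinite M.ground_finite (M.RelaxedIndep A) (.inl M.empty_indep)
    (fun _ _ hJ hIJ ↦ hA.relaxedIndep_subset hJ hIJ)
    (fun _ _ hI hJ h ↦ hA.relaxedIndep_augment hI hJ h)
    (fun _ h ↦ h.subset_ground)).matroid, rfl, fun _ ↦ Iff.rfl⟩

lemma rk_of_relaxedIndep [M.Finite] [P.Finite] (hE : P.E = M.E)
    (hP : ∀ I, P.Indep I ↔ M.RelaxedIndep A I) (hA : M.rk A < M.rk M.E) (hX : X ⊆ M.E) :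
    P.rk X = if M.rk A < (X ∩ A).ncard then min X.ncard (M.rk M.E) else M.rk X := by
  have hle : ∀ I ⊆ X, M.RelaxedIndep A I → I.ncard ≤ P.rk X := fun I hIX hI ↦ by
    rw [← (indep_iff_rk.1 ((hP I).2 hI)).2]
    exact P.rk_mono hIX
  obtain ⟨I, hIX, hI, hIr⟩ := exists_indep_rk (M := P) (hX.trans hE.symm.subset)
  rw [hP] at hI
  have h1 := hI.ncard_le
  have h2 := ncard_mono_ground hIX hX
  have h3 := ncard_mono_ground (M := M) (Set.inter_subset_inter_left A hIX)
    (Set.inter_subset_left.trans hX)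
  split_ifs with h
  -- Once a set has rk A + 1 elements in A, only its size limits independence, so T can be enlarged
  -- freely inside X up to min(|X|, k).
  · obtain ⟨T, hTX, hT⟩ := Set.exists_subset_card_eq (s := X ∩ A) (n := M.rk A + 1) h
    have h4 := ncard_mono_ground (M := M) (Set.inter_subset_left : X ∩ A ⊆ X) hX
    obtain ⟨J, hTJ, hJX, hJ⟩ := Set.exists_subsuperset_card_eq
      (hTX.trans Set.inter_subset_left) (n := min X.ncard (M.rk M.E)) (by omega) (by omega)
    have h5 := ncard_mono_ground (M := M)
      (Set.subset_inter hTJ (hTX.trans Set.inter_subset_right))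
      (Set.inter_subset_left.trans (hJX.trans hX))
    have := hle J hJX (.inr ⟨hJX.trans hX, by omega, by omega⟩)
    omega
  · obtain ⟨J, hJX, hJ, hJr⟩ := exists_indep_rk (M := M) hX
    have h4 := hle J hJX (.inl hJ)
    rcases hI with hI | hI
    · have h5 := M.rk_mono hIX
      rw [(indep_iff_rk.1 hI).2] at h5
      omega
    · omega

lemma IsRelaxation.finite [M.Finite] (h : M.IsRelaxation A P) : P.Finite :=
  ⟨h.2.1 ▸ M.ground_finite⟩

lemma IsRelaxation.unique (h : M.IsRelaxation A P) (h' : M.IsRelaxation A N) : P = N :=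
  ext_isBase (h.2.1.trans h'.2.1.symm) fun B _ ↦ by rw [h.2.2, h'.2.2]

lemma IsStressedCuspidal.exists_isRelaxation_rk [M.Finite] (hA : M.IsStressedCuspidal A) :
    ∃ P : Matroid α, M.IsRelaxation A P ∧ ∀ X ⊆ M.E,
      P.rk X = if M.rk A < (X ∩ A).ncard then min X.ncard (M.rk M.E) else M.rk X := by
  obtain ⟨P, hE, hP⟩ := hA.exists_relaxedIndep
  obtain ⟨hAE, hu, hc, hr1, hr2⟩ := isStressedCuspidal_iff_rk.1 hA
  have : P.Finite := ⟨hE ▸ M.ground_finite⟩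
  have hrk : ∀ X ⊆ M.E, P.rk X =
      if M.rk A < (X ∩ A).ncard then min X.ncard (M.rk M.E) else M.rk X :=
    fun X hX ↦ rk_of_relaxedIndep hE hP hr2 hX
  refine ⟨P, ⟨hA.1, hE, fun B ↦ ?_⟩, hrk⟩
  rw [isBase_iff_rk, isBase_iff_rk, mem_cusp_iff_rk, hE, ← and_or_left]
  refine and_congr_right fun hB ↦ ?_
  have hk : P.rk M.E = M.rk M.E := by
    rw [hrk _ subset_rfl, Set.inter_eq_self_of_subset_right hAE, if_pos hr1]
    have := M.rk_le_ncard (subset_refl M.E)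
    omega
  rw [hk, hrk B hB]
  split_ifs <;> omega

lemma IsRelaxation.rk_eq [M.Finite] (h : M.IsRelaxation A P) (hA : M.IsStressedCuspidal A)
    (hX : X ⊆ M.E) :
    P.rk X = if M.rk A < (X ∩ A).ncard then min X.ncard (M.rk M.E) else M.rk X := by
  obtain ⟨N, hN, hrk⟩ := hA.exists_isRelaxation_rk
  rw [h.unique hN]
  exact hrk X hX

lemma IsRelaxation.rk_le [M.Finite] (h : M.IsRelaxation A P) (hA : M.IsStressedCuspidal A)
    (hX : X ⊆ M.E) : M.rk X ≤ P.rk X := by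
  rw [h.rk_eq hA hX]
  have := M.rk_le_ncard hX
  have := M.rk_mono hX
  split_ifs <;> omega

lemma IsRelaxation.rk_ground [M.Finite] (h : M.IsRelaxation A P) (hA : M.IsStressedCuspidal A) :
    P.rk P.E = M.rk M.E := by
  have h1 := h.rk_le hA subset_rfl
  rw [h.2.1]
  rw [h.rk_eq hA subset_rfl] at h1 ⊢
  split_ifs at * <;> omega

/-! ### Interaction of two stressed subsets, and successive relaxations. -/

lemma IsStressedCuspidal.rk_lt_rk_insert [M.Finite] (hA : M.IsStressedCuspidal A) (he : e ∈ M.E)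
    (heA : e ∉ A) : M.rk A < M.rk (insert e A) := by
  obtain ⟨hAE, hu, hc, hr1, hr2⟩ := isStressedCuspidal_iff_rk.1 hA
  have h1 := hc (insert e A) (Set.insert_subset he hAE) (Set.subset_insert e A)
  rw [Set.insert_sdiff_of_notMem _ heA, Set.sdiff_self, insert_empty_eq,
    Set.ncard_singleton] at h1
  omega

lemma IsStressedCuspidal.eq_of_subset [M.Finite] (hA : M.IsStressedCuspidal A)
    (hB : M.IsStressedCuspidal B) (h : A ⊆ B) : A = B := by
  obtain ⟨hAE, -, -, hA1, -⟩ := isStressedCuspidal_iff_rk.1 hA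
  obtain ⟨hBE, huB, -, -, -⟩ := isStressedCuspidal_iff_rk.1 hB
  refine h.antisymm fun e he ↦ by_contra fun heA ↦ ?_
  have h1 := hA.rk_lt_rk_insert (hBE he) heA
  have h2 := M.rk_mono (Set.insert_subset he h)
  have h3 := huB A h
  omega

/-- Submodularity with rk (A ∪ B) > rk B gives rk (A ∩ B) < rk A, so A ∩ B is independent. If A ∪ B
were not spanning, its rank would be rk A + |B \ A|, and submodularity would give |B| ≤ rk B. So A ∪
B is spanning and submodularity is the claim. -/
lemma IsStressedCuspidal.ncard_inter_add_le [M.Finite] (hA : M.IsStressedCuspidal A)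
    (hB : M.IsStressedCuspidal B) (hne : A ≠ B) :
    (A ∩ B).ncard + M.rk M.E ≤ M.rk A + M.rk B := by
  obtain ⟨hAE, huA, hcA, hA1, hA2⟩ := isStressedCuspidal_iff_rk.1 hA
  obtain ⟨hBE, huB, hcB, hB1, hB2⟩ := isStressedCuspidal_iff_rk.1 hB
  obtain ⟨e, heA, heB⟩ := Set.not_subset.1 fun h ↦ hne (hA.eq_of_subset hB h)
  have h1 := hB.rk_lt_rk_insert (hAE heA) heB
  have h2 := M.rk_mono (Set.insert_subset (Set.mem_union_left B heA) Set.subset_union_right)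
  have h3 := M.rk_submod A B
  have h4 := huA (A ∩ B) Set.inter_subset_left
  have h5 := hcA (A ∪ B) (Set.union_subset hAE hBE) Set.subset_union_left
  rw [Set.union_sdiff_left] at h5
  have h6 := M.ncard_inter_add_ncard_sdiff hBE A
  rw [Set.inter_comm] at h6
  omega

lemma IsRelaxation.rk_eq_of_ne [M.Finite] (h : M.IsRelaxation A P) (hA : M.IsStressedCuspidal A)
    (hB : M.IsStressedCuspidal B) (hne : A ≠ B) (hX : X ⊆ B) : P.rk X = M.rk X := by
  have h1 := hA.ncard_inter_add_le hB hne
  obtain ⟨hBE, -, -, -, hB2⟩ := isStressedCuspidal_iff_rk.1 hB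
  have h2 := ncard_mono_ground (M := M) (show X ∩ A ⊆ A ∩ B by tauto_set)
    (Set.inter_subset_right.trans hBE)
  rw [h.rk_eq hA (hX.trans hBE), if_neg (by omega)]

lemma IsRelaxation.isStressedCuspidal_of_ne [M.Finite] (h : M.IsRelaxation A P)
    (hA : M.IsStressedCuspidal A) (hB : M.IsStressedCuspidal B) (hne : A ≠ B) :
    P.IsStressedCuspidal B := by
  have := h.finite
  have h1 := hA.ncard_inter_add_le hB hne
  obtain ⟨hBE, huB, hcB, hB1, hB2⟩ := isStressedCuspidal_iff_rk.1 hB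
  have hPB := h.rk_eq_of_ne hA hB hne subset_rfl
  have hPk := h.rk_ground hA
  rw [isStressedCuspidal_iff_rk, hPk, hPB, h.2.1]
  refine ⟨hBE, fun X hX ↦ ?_, fun X hX hBX ↦ ?_, hB1, hB2⟩
  · rw [h.rk_eq_of_ne hA hB hne hX, huB X hX]
  · have h2 := hcB X hX hBX
    rw [h.rk_eq hA hX]
    split_ifs with hi
    -- Here |X \ B| ≥ |X ∩ A| - |A ∩ B| > k - rk B, so X is already spanning in M and both minima
    -- equal k.
    · have h3 := M.rk_le_ncard hX
      have h4 := M.ncard_inter_add_ncard_sdiff (Set.inter_subset_left.trans hX : X ∩ A ⊆ M.E) B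
      have h5 := ncard_mono_ground (M := M) (show X ∩ A ∩ B ⊆ A ∩ B by tauto_set)
        (Set.inter_subset_right.trans hBE)
      have h6 := ncard_mono_ground (M := M) (show (X ∩ A) \ B ⊆ X \ B by tauto_set)
        (Set.sdiff_subset.trans hX)
      omega
    · exact h2

lemma IsRelaxation.cusp_eq_of_ne [M.Finite] (h : M.IsRelaxation A P)
    (hA : M.IsStressedCuspidal A) (hB : M.IsStressedCuspidal B) (hne : A ≠ B) :
    P.cusp B = M.cusp B := by
  have := h.finite
  ext S
  rw [mem_cusp_iff_rk, mem_cusp_iff_rk, h.rk_ground hA, h.rk_eq_of_ne hA hB hne subset_rfl, h.2.1]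

lemma RelaxesTo.unique {l : List (Set α)} (h : M.RelaxesTo l P) (h' : M.RelaxesTo l N) :
    P = N := by
  induction h with
  | nil => cases h'; rfl
  | cons h1 _ ih =>
    cases h' with
    | cons h1' h2' => exact ih (h1.unique h1' ▸ h2')

/-- The first relaxation keeps the other subsets stressed and their cusps unchanged, so the cusps
can all be taken in the original M. The final three conclusions serve the statement on cyclic flats.
-/
lemma exists_relaxesTo [M.Finite] (l : List (Set α)) (hl : l.Nodup)
    (h : ∀ A ∈ l, M.IsStressedCuspidal A) :
    ∃ N, M.RelaxesTo l N ∧ N.E = M.E ∧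
      (∀ B, N.IsBase B ↔ M.IsBase B ∨ ∃ A ∈ l, B ∈ M.cusp A) ∧
      (∀ A, A ∉ l → M.IsStressedCuspidal A → N.IsStressedCuspidal A) ∧
      (∀ X ⊆ M.E, M.rk X ≤ N.rk X) ∧ N.rk N.E = M.rk M.E := by
  induction l generalizing M with
  | nil => exact ⟨M, .nil M, rfl, by simp, by simp, fun _ _ ↦ le_rfl, rfl⟩
  | cons A l ih =>
    rw [List.nodup_cons] at hl
    have hA : M.IsStressedCuspidal A := h A (by simp)
    have hl' : ∀ B ∈ l, M.IsStressedCuspidal B := fun B hB ↦ h B (by simp [hB])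
    have hne : ∀ B ∈ l, A ≠ B := fun B hB hAB ↦ hl.1 (hAB ▸ hB)
    obtain ⟨P, hP, -⟩ := hA.exists_isRelaxation_rk
    have := hP.finite
    obtain ⟨N, hN, hNE, hNb, hNs, hNr, hNk⟩ := ih hl.2
      fun B hB ↦ hP.isStressedCuspidal_of_ne hA (hl' B hB) (hne B hB)
    refine ⟨N, .cons hP hN, hNE.trans hP.2.1, fun B ↦ ?_, fun B hB hBs ↦ ?_,
      fun X hX ↦ (hP.rk_le hA hX).trans (hNr X (hP.2.1 ▸ hX)), hNk.trans (hP.rk_ground hA)⟩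
    · rw [hNb, hP.2.2, or_assoc]
      refine or_congr_right ?_
      simp only [List.mem_cons, exists_eq_or_imp]
      refine or_congr_right (exists_congr fun C ↦ and_congr_right fun hC ↦ ?_)
      rw [hP.cusp_eq_of_ne hA (hl' C hC) (hne C hC)]
    · rw [List.mem_cons, not_or] at hB
      exact hNs B hB.2 (hP.isStressedCuspidal_of_ne hA hBs (Ne.symm hB.1))

end Relaxation

end Matroid

namespace Matroid

/-! ### Elementary split matroids and non-spanning circuits. -/

section ElementarySplit

variable {α : Type*} {M N P : Matroid α} {A B C D F G I K S X Y : Set α} {e : α}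

lemma union_sdiff_sdiff_eq {E : Set α} (hG : G ⊆ E) (hX : X ⊆ E \ G) :
    G ∪ ((E \ G) \ X) = E \ X := by tauto_set

lemma sdiff_sdiff_sdiff_eq {E : Set α} (hG : G ⊆ E) (hX : X ⊆ E \ G) :
    E \ ((E \ G) \ X) = G ∪ X := by tauto_set

/-- Every `rk M`-element subset of the ground set is a base or lies in the cusp of a stressed
subset if and only if every non-spanning circuit spans a stressed subset. -/
lemma forall_isBase_or_mem_cusp_iff [M.Finite] :
    (∀ S ⊆ M.E, S.ncard = M.rk M.E →
      M.IsBase S ∨ ∃ A, M.IsStressedCuspidal A ∧ S ∈ M.cusp A) ↔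
    ∀ C, M.IsCircuit C → M.rk C < M.rk M.E →
      ∃ A, M.IsStressedCuspidal A ∧ C ⊆ A ∧ M.rk A = M.rk C := by
  constructor
  · intro h C hC hCk
    obtain ⟨hCc, hCp⟩ := isCircuit_rk hC
    have hE := M.rk_le_ncard (subset_refl M.E)
    obtain ⟨S, hCS, hSE, hS⟩ :=
      Set.exists_subsuperset_card_eq hC.subset_ground (n := M.rk M.E) (by omega) (by omega)
    rcases h S hSE hS with hB | ⟨A, hA, hSA⟩
    · exact (hC.not_indep (hB.indep.subset hCS)).elim
    obtain ⟨hAE, hu, hc, -, -⟩ := isStressedCuspidal_iff_rk.1 hA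
    rw [mem_cusp_iff_rk] at hSA
    have hCA : C ⊆ A := by
      -- Otherwise C ∩ A is independent, and submodularity of C and A rules out rk (C ∪ A) = rk A +
      -- |C \ A|. Spanning is excluded too, because |C \ A| ≤ |S \ A| < k - rk A.
      by_contra hCA
      have h1 := hCp (C ∩ A) ⟨Set.inter_subset_left, fun h' ↦ hCA (h'.trans Set.inter_subset_right)⟩
      have h2 := hc (C ∪ A) (Set.union_subset hC.subset_ground hAE) Set.subset_union_right
      rw [Set.union_sdiff_right] at h2
      have h3 := M.rk_submod C A
      have h4 := M.ncard_inter_add_ncard_sdiff hSE A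
      have h5 := M.ncard_inter_add_ncard_sdiff hC.subset_ground A
      have h6 := ncard_mono_ground (M := M) (Set.sdiff_subset_sdiff_left hCS : C \ A ⊆ S \ A)
        (Set.sdiff_subset.trans hSE)
      omega
    have := hu C hCA
    exact ⟨A, hA, hCA, by omega⟩
  · intro h S hSE hS
    rw [or_iff_not_imp_left, isBase_iff_rk]
    intro hB
    have hlt : M.rk S < M.rk M.E := lt_of_le_of_ne (M.rk_mono hSE) fun h' ↦ hB ⟨hSE, hS, h'⟩
    obtain ⟨C, hCS, hC⟩ := exists_isCircuit_of_rk_lt hSE (hS ▸ hlt)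
    obtain ⟨A, hA, hCA, hr⟩ := h C hC ((M.rk_mono hCS).trans_lt hlt)
    refine ⟨A, hA, mem_cusp_iff_rk.2 ⟨hSE, hS, ?_⟩⟩
    have h1 := ncard_mono_ground (M := M) (Set.subset_inter hCS hCA)
      (Set.inter_subset_left.trans hSE)
    have h2 := (isCircuit_rk hC).1
    omega

lemma rk_insert_le_of_subset [M.Finite] (hXY : X ⊆ Y) (h : M.rk (insert e X) ≤ M.rk X) :
    M.rk (insert e Y) ≤ M.rk Y := by
  have h1 := M.rk_submod Y (insert e X)
  have h2 := M.rk_mono (Set.subset_inter hXY (Set.subset_insert e X))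
  have h3 : Y ∪ insert e X = insert e Y := by
    rw [Set.union_insert, Set.union_eq_self_of_subset_right hXY]
  rw [h3] at h1
  omega

/-- A non-spanning circuit in F spans a stressed A, and A ⊆ F because F is flat. As F is not
spanning, rk F = rk A + |F \ A|, so A separates M|F; connectedness leaves A = F. -/
lemma isStressed_of_isSplitFlacet [M.Finite]
    (h : ∀ C, M.IsCircuit C → M.rk C < M.rk M.E →
      ∃ A, M.IsStressedCuspidal A ∧ C ⊆ A ∧ M.rk A = M.rk C)
    (hF : M.IsSplitFlacet F) : M.IsStressed F := by
  obtain ⟨⟨hfl, hcon, -⟩, -, hlt, e, heE, -⟩ := hF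
  obtain ⟨hFE, hfl⟩ := isFlat_iff_rk.1 hfl
  rw [isConnected_restrict_iff_rk hFE] at hcon
  rw [← coe_rk, ← (M.set_finite F hFE).cast_ncard_eq, Nat.cast_lt] at hlt
  have hFk : M.rk F < M.rk M.E :=
    (hfl e heE.1 heE.2).trans_le (M.rk_mono (Set.insert_subset heE.1 hFE))
  obtain ⟨C, hCF, hC⟩ := exists_isCircuit_of_rk_lt hFE hlt
  obtain ⟨A, hA, hCA, hr⟩ := h C hC ((M.rk_mono hCF).trans_lt hFk)
  obtain ⟨hAE, hu, hc, hA1, hA2⟩ := isStressedCuspidal_iff_rk.1 hA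
  have hAF : A ⊆ F := fun x hx ↦ by_contra fun hxF ↦ by
    have h1 := M.rk_mono (Set.insert_subset hx hCA)
    have h2 := rk_insert_le_of_subset hCF (h1.trans hr.le)
    have h3 := hfl x (hAE hx) hxF
    omega
  have h1 := hc F hFE hAF
  have h2 := M.rk_le_ncard (Set.sdiff_subset.trans hFE : F \ A ⊆ M.E)
  rcases hcon A hAF (by omega) with rfl | rfl
  · simp at hA1
  · exact hA.1

/-- X \ A separates the uniform matroid M/A, which has positive rank. Either X = A, or M/A is free,
and then k = rk A + |E \ A|. -/
lemma IsStressedCuspidal.rk_add_rk_compl_of_subset [M.Finite] (hA : M.IsStressedCuspidal A)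
    (hX : X ⊆ M.E) (h : M.rk X + M.rk (M.E \ X) ≤ M.rk M.E) (hXE : X ≠ M.E) (hAX : A ⊆ X) :
    M.rk A + M.rk (M.E \ A) ≤ M.rk M.E := by
  have hAE := hA.subset_ground
  have e1 : (A ∪ (M.E \ X)) \ A = M.E \ X := by tauto_set
  have e2 : (A ∪ (M.E \ X)) \ X = M.E \ X := by tauto_set
  have e3 : (A ∪ (M.E \ X)) ∩ X = A := by tauto_set
  have e4 : (M.E \ A) ∩ X = X \ A := by
    rw [Set.inter_comm, ← Set.inter_sdiff_assoc, Set.inter_eq_self_of_subset_left hX]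
  have e5 : (M.E \ A) \ X = M.E \ X := by
    rw [Set.sdiff_sdiff, Set.union_eq_self_of_subset_left hAX]
  have e6 : A ∪ (M.E \ X) ⊆ M.E := Set.union_subset hAE Set.sdiff_subset
  obtain ⟨-, hu, hc, hA1, hA2⟩ := isStressedCuspidal_iff_rk.1 hA
  have h1 := hc X hX hAX
  have h2 := hc (A ∪ (M.E \ X)) e6 Set.subset_union_left
  have h3 := rk_inter_add_rk_sdiff hX h e6
  rw [e1] at h2
  rw [e2, e3] at h3
  have h4 := M.ncard_inter_add_ncard_sdiff (Set.sdiff_subset : M.E \ A ⊆ M.E) X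
  rw [e4, e5] at h4
  have h5 := M.rk_le_ncard (Set.sdiff_subset : M.E \ A ⊆ M.E)
  have h6 : 0 < (M.E \ X).ncard := (Set.ncard_pos (M.set_finite _ Set.sdiff_subset)).2
    (Set.sdiff_nonempty.2 fun h' ↦ hXE (hX.antisymm h'))
  have h7 := rk_inter_add_rk_sdiff hX h subset_rfl
  rw [Set.inter_eq_self_of_subset_right hX] at h7
  by_cases h8 : (X \ A).ncard = 0
  · rw [Set.ncard_eq_zero (M.set_finite _ (Set.sdiff_subset.trans hX)), Set.sdiff_eq_empty] at h8
    rwa [hAX.antisymm h8]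
  · omega

/-- If rk A > 0, the uniform M|A has rank strictly between 0 and |A|, hence is connected and lies on
one side of the separator X. -/
lemma IsStressedCuspidal.rk_add_rk_compl [M.Finite] (hA : M.IsStressedCuspidal A)
    (hX : X ⊆ M.E) (h : M.rk X + M.rk (M.E \ X) ≤ M.rk M.E) (hX0 : X ≠ ∅) (hXE : X ≠ M.E) :
    M.rk A + M.rk (M.E \ A) ≤ M.rk M.E := by
  obtain ⟨hAE, hu, hc, hA1, hA2⟩ := isStressedCuspidal_iff_rk.1 hA
  by_cases h0 : M.rk A = 0
  · have := M.rk_mono (Set.sdiff_subset : M.E \ A ⊆ M.E)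
    omega
  have h1 := rk_inter_add_rk_sdiff hX h hAE
  rw [hu _ Set.inter_subset_left, hu _ Set.sdiff_subset] at h1
  have h2 := M.ncard_inter_add_ncard_sdiff hAE X
  rcases (show (A ∩ X).ncard = 0 ∨ (A \ X).ncard = 0 by omega) with h3 | h3
  · rw [Set.ncard_eq_zero (M.set_finite _ (Set.inter_subset_left.trans hAE))] at h3
    refine hA.rk_add_rk_compl_of_subset (X := M.E \ X) Set.sdiff_subset ?_ ?_ ?_
    · rwa [Set.sdiff_sdiff_cancel_left hX, add_comm]
    · exact fun h' ↦ hX0 (by rw [← Set.sdiff_sdiff_cancel_left hX, h', Set.sdiff_self])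
    · exact Set.subset_sdiff.2 ⟨hAE, Set.disjoint_iff_inter_eq_empty.2 h3⟩
  · rw [Set.ncard_eq_zero (M.set_finite _ (Set.sdiff_subset.trans hAE)), Set.sdiff_eq_empty] at h3
    exact hA.rk_add_rk_compl_of_subset hX h hXE h3

lemma isElementarySplit_of_forall_isCircuit [M.Finite]
    (h : ∀ C, M.IsCircuit C → M.rk C < M.rk M.E →
      ∃ A, M.IsStressedCuspidal A ∧ C ⊆ A ∧ M.rk A = M.rk C) : M.IsElementarySplit := by
  by_cases hM : M.IsConnected
  · exact .inl ⟨hM, fun F hF ↦ isStressed_of_isSplitFlacet h hF⟩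
  refine .inr (exists_disjointSum_isUniform_iff_rk.2 ?_)
  rw [isConnected_iff_rk] at hM
  push Not at hM
  obtain ⟨X, hX, hsep, hX0, hXE⟩ := hM
  by_cases hA : ∃ A, M.IsStressedCuspidal A
  · obtain ⟨A, hA⟩ := hA
    have hsA := hA.rk_add_rk_compl hX hsep hX0.ne_empty hXE
    obtain ⟨hAE, hu, hc, hA1, hA2⟩ := isStressedCuspidal_iff_rk.1 hA
    refine ⟨A, hAE, hsA, hu, fun Y hY ↦ ?_⟩
    have h1 := hc (Y ∪ A) (by tauto_set) Set.subset_union_right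
    have h2 := rk_inter_add_rk_sdiff hAE hsA (show Y ∪ A ⊆ M.E by tauto_set)
    have h3 := rk_inter_add_rk_sdiff hAE hsA subset_rfl
    have e1 : (Y ∪ A) \ A = Y := by tauto_set
    rw [e1, Set.inter_eq_self_of_subset_right Set.subset_union_right] at h2
    rw [e1] at h1
    rw [Set.inter_eq_self_of_subset_right hAE] at h3
    omega
  · refine ⟨M.E, subset_rfl, by simp [rk_empty], fun Y hY ↦ ?_, fun Y hY ↦ ?_⟩
    · have h1 := M.rk_le_ncard hY
      have h2 := M.rk_mono hY
      by_contra hne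
      obtain ⟨C, hCY, hC⟩ := exists_isCircuit_of_rk_lt hY (by omega)
      have h3 := M.rk_mono hCY
      obtain ⟨A, hA', -⟩ := h C hC (by omega)
      exact hA ⟨A, hA'⟩
    · rw [Set.sdiff_self, Set.subset_empty_iff] at hY
      simp [hY, rk_empty]

lemma isStressedCuspidal_of_isUniform_summands [M.Finite] (hX : X ⊆ M.E)
    (h : M.rk X + M.rk (M.E \ X) ≤ M.rk M.E) (hu : ∀ Y ⊆ X, M.rk Y = min Y.ncard (M.rk X))
    (hv : ∀ Y ⊆ M.E \ X, M.rk Y = min Y.ncard (M.rk (M.E \ X))) (hC : M.IsCircuit C)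
    (hCX : C ⊆ X) (hCk : M.rk C < M.rk M.E) :
    ∃ A, M.IsStressedCuspidal A ∧ C ⊆ A ∧ M.rk A = M.rk C := by
  have h1 := hu C hCX
  have h2 := (isCircuit_rk hC).1
  have h3 := ncard_mono_ground hCX hX
  have h4 := rk_inter_add_rk_sdiff hX h subset_rfl
  rw [Set.inter_eq_self_of_subset_right hX] at h4
  refine ⟨X, isStressedCuspidal_iff_rk.2 ⟨hX, hu, fun Z hZ hXZ ↦ ?_, by omega, by omega⟩, hCX,
    by omega⟩
  have h5 := rk_inter_add_rk_sdiff hX h hZ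
  have h6 := hv (Z \ X) (Set.sdiff_subset_sdiff_left hZ)
  rw [Set.inter_eq_self_of_subset_right hXZ] at h5
  omega

lemma IsCircuit.subset_or_subset_sdiff [M.Finite] (hC : M.IsCircuit C) {Z : Set α} (hCZ : C ⊆ Z)
    (hX : X ⊆ Z) (h : M.rk X + M.rk (Z \ X) ≤ M.rk Z) : C ⊆ X ∨ C ⊆ Z \ X := by
  obtain ⟨h1, h2⟩ := isCircuit_rk hC
  by_contra! hcon
  have h3 := h2 (C ∩ X) ⟨Set.inter_subset_left, fun h' ↦ hcon.1 (by tauto_set)⟩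
  have h4 := h2 (C \ X) ⟨Set.sdiff_subset, fun h' ↦ hcon.2 (by tauto_set)⟩
  have h5 := rk_inter_add_rk_sdiff hX h hCZ
  have h6 := M.ncard_inter_add_ncard_sdiff hC.subset_ground X
  omega

/-- K separates M/G and Y separates M|(G ∪ K). Submodularity applied to (G ∪ K) \ Y and E \ K, which
meet in G, shows that Y separates M; it misses G, so it is not E. -/
lemma eq_empty_of_rk_add_rk_sdiff [M.Finite]
    (hM : ∀ X ⊆ M.E, M.rk X + M.rk (M.E \ X) ≤ M.rk M.E → X = ∅ ∨ X = M.E)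
    (hG : G ⊆ M.E) (hG0 : G.Nonempty) (hK : K ⊆ M.E \ G)
    (h : M.rk (G ∪ K) + M.rk (M.E \ K) ≤ M.rk M.E + M.rk G) (hY : Y ⊆ K)
    (hr : M.rk Y + M.rk ((G ∪ K) \ Y) ≤ M.rk (G ∪ K)) : Y = ∅ := by
  have h1 := M.rk_submod ((G ∪ K) \ Y) (M.E \ K)
  have e1 : (G ∪ K) \ Y ∩ (M.E \ K) = G := by tauto_set
  have e2 : (G ∪ K) \ Y ∪ (M.E \ K) = M.E \ Y := by tauto_set
  rw [e1, e2] at h1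
  refine (hM Y (by tauto_set) (by omega)).resolve_right fun h' ↦ ?_
  obtain ⟨x, hx⟩ := hG0
  exact (hK (hY (h' ▸ hG hx))).2 hx

/-- In a connected matroid, a connected set stays connected when a separator of its contraction is
added to it. -/
lemma connected_union_of_rk [M.Finite]
    (hM : ∀ X ⊆ M.E, M.rk X + M.rk (M.E \ X) ≤ M.rk M.E → X = ∅ ∨ X = M.E)
    (hG : G ⊆ M.E) (hG0 : G.Nonempty)
    (hGc : ∀ X ⊆ G, M.rk X + M.rk (G \ X) ≤ M.rk G → X = ∅ ∨ X = G) (hK : K ⊆ M.E \ G)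
    (h : M.rk (G ∪ K) + M.rk (M.E \ K) ≤ M.rk M.E + M.rk G) :
    ∀ X ⊆ G ∪ K, M.rk X + M.rk ((G ∪ K) \ X) ≤ M.rk (G ∪ K) → X = ∅ ∨ X = G ∪ K := by
  intro X hX hr
  have h1 := rk_inter_add_rk_sdiff hX hr (Set.subset_union_left : G ⊆ G ∪ K)
  have e1 : G \ (G ∩ X) = G \ X := by tauto_set
  rcases hGc (G ∩ X) Set.inter_subset_left (by rw [e1]; omega) with h2 | h2
  · exact .inl (eq_empty_of_rk_add_rk_sdiff hM hG hG0 hK h (by tauto_set) hr)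
  · have h3 := eq_empty_of_rk_add_rk_sdiff (Y := (G ∪ K) \ X) hM hG hG0 hK h (by tauto_set)
      (by rwa [Set.sdiff_sdiff_cancel_left hX, add_comm])
    exact .inr (hX.antisymm (Set.sdiff_eq_empty.1 h3))

lemma IsConnected.exists_isSplitFlacet_superset [M.Finite] (hM : M.IsConnected)
    (hC : M.IsCircuit C) (hCk : M.rk C < M.rk M.E) :
    ∃ G, C ⊆ G ∧ M.IsSplitFlacet G ∧ M.rk G < M.rk M.E := by
  rw [isConnected_iff_rk] at hM
  obtain ⟨hCc, hCp⟩ := isCircuit_rk hC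
  set 𝒢 : Set (Set α) := {G | C ⊆ G ∧ G ⊆ M.E ∧ M.rk G < M.rk M.E ∧
    ∀ X ⊆ G, M.rk X + M.rk (G \ X) ≤ M.rk G → X = ∅ ∨ X = G} with h𝒢
  have hfin : 𝒢.Finite := M.ground_finite.finite_subsets.subset fun G hG ↦ hG.2.1
  have hC𝒢 : C ∈ 𝒢 := by
    refine ⟨subset_rfl, hC.subset_ground, hCk, fun X hX hr ↦ ?_⟩
    by_contra! hcon
    have h1 := hCp X (hX.ssubset_of_ne hcon.2)
    have h2 := hCp (C \ X) ⟨Set.sdiff_subset, fun h' ↦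
      hcon.1.ne_empty (disjoint_self.1 (Set.disjoint_of_subset_left (hX.trans h')
        Set.disjoint_sdiff_left))⟩
    have h3 := M.ncard_inter_add_ncard_sdiff hC.subset_ground X
    rw [Set.inter_eq_self_of_subset_right hX] at h3
    omega
  -- By maximality no non-empty separator K of M/G has G ∪ K non-spanning. An element of the closure
  -- of G would be such a K, so G is flat. Of two complementary separators of M/G, at least one has
  -- a non-spanning union with G, so M/G is connected.
  obtain ⟨G, -, hmax⟩ := hfin.exists_le_maximal hC𝒢
  obtain ⟨hCG, hGE, hGk, hGc⟩ := hmax.prop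
  have hG0 : G.Nonempty := hC.nonempty.mono hCG
  have hext : ∀ K ⊆ M.E \ G, M.rk (G ∪ K) + M.rk (M.E \ K) ≤ M.rk M.E + M.rk G →
      M.rk (G ∪ K) < M.rk M.E → K = ∅ := by
    intro K hK h1 h2
    have h3 : G ∪ K ∈ 𝒢 := ⟨hCG.trans Set.subset_union_left,
      Set.union_subset hGE (hK.trans Set.sdiff_subset), h2,
      connected_union_of_rk hM hGE hG0 hGc hK h1⟩
    have h4 : G ∪ K ⊆ G := hmax.le_of_ge h3 Set.subset_union_left
    exact disjoint_self.1 (Set.disjoint_of_subset hK (Set.subset_union_right.trans h4)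
      Set.disjoint_sdiff_left)
  have hflat : M.IsFlat G := by
    refine isFlat_iff_rk.2 ⟨hGE, fun e he heG ↦ ?_⟩
    by_contra! hcon
    rw [← Set.union_singleton] at hcon
    have := M.rk_mono (Set.sdiff_subset : M.E \ {e} ⊆ M.E)
    exact Set.singleton_ne_empty e (hext {e} (by simpa using ⟨he, heG⟩) (by omega) (by omega))
  have hcontr : (M ／ G).IsConnected := by
    refine isConnected_contract_of_rk hGE fun X hX hr ↦ ?_
    rw [Set.union_comm] at hr
    rcases lt_or_ge (M.rk (G ∪ X)) (M.rk M.E) with h1 | h1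
    · exact .inl (hext X hX hr h1)
    · have e1 := union_sdiff_sdiff_eq hGE hX
      have e2 := sdiff_sdiff_sdiff_eq hGE hX
      have h2 := hext ((M.E \ G) \ X) Set.sdiff_subset (by rw [e1, e2]; omega) (by rw [e1]; omega)
      exact .inr (hX.antisymm (Set.sdiff_eq_empty.1 h2))
  have hGne : G ≠ M.E := by
    rintro rfl
    exact lt_irrefl _ hGk
  refine ⟨G, hCG, ⟨⟨hflat, (isConnected_restrict_iff_rk hGE).2 hGc, hcontr⟩, ?_, ?_, ?_⟩, hGk⟩
  · rw [← coe_rk, Nat.cast_pos]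
    by_contra! h0
    have := M.rk_mono (Set.sdiff_subset : M.E \ G ⊆ M.E)
    rcases hM G hGE (by omega) with h1 | h1
    · exact hG0.ne_empty h1
    · exact hGne h1
  · rw [← coe_rk, ← (M.set_finite G hGE).cast_ncard_eq, Nat.cast_lt]
    refine lt_of_le_of_ne (M.rk_le_ncard hGE) fun h1 ↦ ?_
    exact hC.not_indep ((indep_iff_rk.2 ⟨hGE, h1⟩).subset hCG)
  · obtain ⟨e, heE, heG⟩ := Set.not_subset.1 fun h' ↦ hGne (hGE.antisymm h')
    refine ⟨e, ⟨heE, heG⟩, fun hco ↦ ?_⟩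
    rw [isColoop_iff_rk heE] at hco
    have := M.rk_singleton_le e
    rcases hM {e} (by simpa using heE) (by omega) with h1 | h1
    · exact Set.singleton_ne_empty e h1
    · obtain ⟨x, hx⟩ := hG0
      have hxe : x = e := by simpa [← h1] using hGE hx
      exact heG (hxe ▸ hx)

lemma isElementarySplit_iff [M.Finite] :
    M.IsElementarySplit ↔ ∀ C, M.IsCircuit C → M.rk C < M.rk M.E →
      ∃ A, M.IsStressedCuspidal A ∧ C ⊆ A ∧ M.rk A = M.rk C := by
  refine ⟨?_, isElementarySplit_of_forall_isCircuit⟩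
  rintro (⟨hM, hs⟩ | hsum) C hC hCk
  · obtain ⟨G, hCG, hG, hGk⟩ := hM.exists_isSplitFlacet_superset hC hCk
    obtain ⟨hGE, hu, hc⟩ := hs G hG
    have hlt := hG.2.2.1
    rw [← coe_rk, ← (M.set_finite G hGE).cast_ncard_eq, Nat.cast_lt] at hlt
    rw [isUniform_restrict_iff_rk hGE] at hu
    refine ⟨G, isStressedCuspidal_iff_rk.2
      ⟨hGE, hu, (isUniform_contract_iff_rk hGE).1 hc, hlt, hGk⟩, hCG, ?_⟩
    have h1 := hu C hCG
    have h2 := (isCircuit_rk hC).1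
    omega
  · obtain ⟨X, hX, h, hu, hv⟩ := exists_disjointSum_isUniform_iff_rk.1 hsum
    rcases hC.subset_or_subset_sdiff hC.subset_ground hX h with hCX | hCX
    · exact isStressedCuspidal_of_isUniform_summands hX h hu hv hC hCX hCk
    · refine isStressedCuspidal_of_isUniform_summands (X := M.E \ X) Set.sdiff_subset ?_ hv ?_ hC
        hCX hCk
      · rwa [Set.sdiff_sdiff_cancel_left hX, add_comm]
      · rwa [Set.sdiff_sdiff_cancel_left hX]

end ElementarySplit

end Matroid

namespace Matroid

/-! ### Cyclic flats before and after a relaxation. -/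

section CyclicFlats

variable {α : Type*} {M N P : Matroid α} {A B C D F G I K S X Y Z : Set α} {e : α}

lemma IsStressedCuspidal.isCyclicFlat [M.Finite] (hA : M.IsStressedCuspidal A) :
    M.IsCyclicFlat A := by
  obtain ⟨hAE, hu, -, hA1, -⟩ := isStressedCuspidal_iff_rk.1 hA
  refine isCyclicFlat_iff_rk.2 ⟨hAE, fun e he heA ↦ hA.rk_lt_rk_insert he heA, fun e he ↦ ?_⟩
  have h1 := hu (A \ {e}) Set.sdiff_subset
  have h2 := Set.ncard_sdiff_singleton_add_one he (M.set_finite A hAE)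
  omega

lemma IsCyclicFlat.eq_ground_of_rk [M.Finite] (hZ : M.IsCyclicFlat Z)
    (h : M.rk M.E ≤ M.rk Z) : Z = M.E := by
  obtain ⟨hZE, hfl, -⟩ := isCyclicFlat_iff_rk.1 hZ
  refine hZE.antisymm fun e he ↦ by_contra fun heZ ↦ ?_
  have h1 := hfl e he heZ
  have h2 := M.rk_mono (Set.insert_subset he hZE)
  omega

/-- A non-empty cyclic set in the uniform M|A has full rank rk A, and a flat of that rank inside A
is A. -/
lemma IsCyclicFlat.eq_of_subset_of_isStressedCuspidal [M.Finite] (hZ : M.IsCyclicFlat Z)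
    (hA : M.IsStressedCuspidal A) (hZA : Z ⊆ A) (hZ0 : Z.Nonempty) : Z = A := by
  obtain ⟨hAE, hu, -, -, -⟩ := isStressedCuspidal_iff_rk.1 hA
  obtain ⟨hZE, hfl, hcy⟩ := isCyclicFlat_iff_rk.1 hZ
  obtain ⟨e, he⟩ := hZ0
  have h1 := hcy e he
  rw [hu Z hZA, hu _ (Set.sdiff_subset.trans hZA)] at h1
  have h2 := Set.ncard_sdiff_singleton_add_one he (M.set_finite Z hZE)
  have h3 := hu Z hZA
  refine hZA.antisymm fun x hx ↦ by_contra fun hxZ ↦ ?_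
  have h4 := hfl x (hAE hx) hxZ
  have h5 := M.rk_mono (Set.insert_subset hx hZA)
  omega

lemma IsCyclicFlat.eq_ground_of_isStressedCuspidal_subset [M.Finite] (hZ : M.IsCyclicFlat Z)
    (hA : M.IsStressedCuspidal A) (hAZ : A ⊆ Z) (hne : Z ≠ A) : Z = M.E := by
  obtain ⟨hAE, -, hc, -, -⟩ := isStressedCuspidal_iff_rk.1 hA
  obtain ⟨hZE, hfl, hcy⟩ := isCyclicFlat_iff_rk.1 hZ
  obtain ⟨e, he, heA⟩ := Set.not_subset.1 fun h ↦ hne (h.antisymm hAZ)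
  have h1 := hcy e he
  rw [hc Z hZE hAZ, hc _ (Set.sdiff_subset.trans hZE) (Set.subset_sdiff_singleton hAZ heA),
    Set.sdiff_sdiff_comm] at h1
  have h2 := Set.ncard_sdiff_singleton_add_one (show e ∈ Z \ A from ⟨he, heA⟩)
    (M.set_finite _ (Set.sdiff_subset.trans hZE))
  have h3 := hc Z hZE hAZ
  exact hZ.eq_ground_of_rk (by omega)

lemma isCyclicFlat_empty [M.Finite] (hl : ∀ e ∈ M.E, 0 < M.rk {e}) : M.IsCyclicFlat ∅ :=
  isCyclicFlat_iff_rk.2 ⟨Set.empty_subset _, fun e he _ ↦ by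
    rw [insert_empty_eq, rk_empty]
    exact hl e he, by simp⟩

lemma isCyclicFlat_ground [M.Finite] (hco : ∀ e ∈ M.E, M.rk (M.E \ {e}) = M.rk M.E) :
    M.IsCyclicFlat M.E :=
  isCyclicFlat_iff_rk.2 ⟨subset_rfl, fun _ he he' ↦ (he' he).elim, hco⟩

lemma IsStressedCuspidal.nonempty [M.Finite] (hA : M.IsStressedCuspidal A) : A.Nonempty := by
  rw [Set.nonempty_iff_ne_empty]
  rintro rfl
  have := (isStressedCuspidal_iff_rk.1 hA).2.2.2.1
  simp at this

lemma IsStressedCuspidal.ne_ground [M.Finite] (hA : M.IsStressedCuspidal A) : A ≠ M.E := by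
  rintro rfl
  exact lt_irrefl _ (isStressedCuspidal_iff_rk.1 hA).2.2.2.2

lemma IsStressedCuspidal.empty_covBy [M.Finite] (hA : M.IsStressedCuspidal A)
    (hl : ∀ e ∈ M.E, 0 < M.rk {e}) : M.CyclicFlatCovBy ∅ A := by
  refine ⟨isCyclicFlat_empty hl, hA.isCyclicFlat, ?_, ?_⟩
  · exact Set.empty_ssubset.2 hA.nonempty
  · rintro ⟨Z, hZ⟩ h1 h2
    have h1' : ∅ ⊂ Z := h1
    have h2' : Z ⊂ A := h2
    exact h2'.ne (IsCyclicFlat.eq_of_subset_of_isStressedCuspidal hZ hA h2'.subset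
      (Set.empty_ssubset.1 h1'))

lemma IsStressedCuspidal.covBy_ground [M.Finite] (hA : M.IsStressedCuspidal A)
    (hco : ∀ e ∈ M.E, M.rk (M.E \ {e}) = M.rk M.E) : M.CyclicFlatCovBy A M.E := by
  refine ⟨hA.isCyclicFlat, isCyclicFlat_ground hco, ?_, ?_⟩
  · exact hA.subset_ground.ssubset_of_ne hA.ne_ground
  · rintro ⟨Z, hZ⟩ h1 h2
    have h1' : A ⊂ Z := h1
    have h2' : Z ⊂ M.E := h2
    exact h2'.ne (IsCyclicFlat.eq_ground_of_isStressedCuspidal_subset hZ hA h1'.subset h1'.ne')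

lemma IsRelaxation.isCyclicFlat_of_isCyclicFlat [M.Finite] (h : M.IsRelaxation A P)
    (hA : M.IsStressedCuspidal A) (hl : ∀ e ∈ M.E, 0 < M.rk {e})
    (hco : ∀ e ∈ M.E, M.rk (M.E \ {e}) = M.rk M.E) (hZ : P.IsCyclicFlat Z) :
    M.IsCyclicFlat Z ∧ Z ≠ A ∧ P.rk Z = M.rk Z := by
  have := h.finite
  have hk := h.rk_ground hA
  obtain ⟨hAE, hu, hc, hA1, hA2⟩ := isStressedCuspidal_iff_rk.1 hA
  obtain ⟨hZE, hfl, hcy⟩ := isCyclicFlat_iff_rk.1 hZ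
  rw [h.2.1] at hZE hfl
  rcases lt_or_ge (M.rk A) (Z ∩ A).ncard with hi | hi
  -- In P such a Z has rank min(|Z|, k). Cyclicity makes this at most |Z| - 1, so it is k.
  · have hZk : P.rk P.E ≤ P.rk Z := by
      obtain ⟨e, he⟩ := Set.nonempty_of_ncard_ne_zero (s := Z ∩ A) (by omega)
      have h1 := hcy e he.1
      have h2 := P.rk_le_ncard (X := Z \ {e}) (Set.sdiff_subset.trans (h.2.1 ▸ hZE))
      have h3 := Set.ncard_sdiff_singleton_add_one he.1 (M.set_finite Z hZE)
      have h4 := h.rk_eq hA hZE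
      rw [if_pos hi] at h4
      omega
    have hZe : Z = M.E := (hZ.eq_ground_of_rk hZk).trans h.2.1
    subst hZe
    exact ⟨isCyclicFlat_ground hco, hA.ne_ground.symm, by rw [← hk, h.2.1]⟩
  · have hsub : ∀ X ⊆ Z, P.rk X = M.rk X := fun X hX ↦ by
      have h1 := ncard_mono_ground (M := M) (Set.inter_subset_inter_left A hX)
        (Set.inter_subset_left.trans hZE)
      rw [h.rk_eq hA (hX.trans hZE), if_neg (by omega)]
    refine ⟨isCyclicFlat_iff_rk.2 ⟨hZE, fun e he heZ ↦ ?_, fun e he ↦ ?_⟩, ?_, hsub Z subset_rfl⟩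
    · have h1 := hfl e he heZ
      have h2 := h.rk_eq hA (Set.insert_subset he hZE)
      rw [hsub Z subset_rfl] at h1
      split_ifs at h2 with hi'
      · have h3 : (insert e Z ∩ A).ncard ≤ (Z ∩ A).ncard + 1 :=
          (Set.ncard_le_ncard (t := insert e (Z ∩ A))
            (fun x hx ↦ hx.1.elim .inl fun hx' ↦ .inr ⟨hx', hx.2⟩)
            ((M.set_finite _ (Set.inter_subset_left.trans hZE)).insert e)).trans
          (Set.ncard_insert_le e _)
        -- Adding e crosses the threshold, so |Z ∩ A| = rk A and Z ∩ A spans A. Hence rk Z = rk (Z ∪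
        -- A) = min(|Z|, k), and rk Z < k makes Z independent. A non-empty cyclic set is not
        -- independent, so only Z = ∅ is left, where looplessness is used.
        have h4 := hu (Z ∩ A) Set.inter_subset_right
        have h5 := M.rk_submod Z A
        have h6 := hc (Z ∪ A) (Set.union_subset hZE hAE) Set.subset_union_right
        rw [Set.union_sdiff_right] at h6
        have h7 := M.ncard_inter_add_ncard_sdiff hZE A
        have h8 := M.rk_le_ncard hZE
        rcases Z.eq_empty_or_nonempty with rfl | ⟨x, hx⟩
        · rw [insert_empty_eq, rk_empty]
          exact hl e he
        · have h9 := hcy x hx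
          rw [hsub Z subset_rfl] at h9
          have h10 := P.rk_le_ncard (X := Z \ {x}) (Set.sdiff_subset.trans (h.2.1 ▸ hZE))
          have h11 := Set.ncard_sdiff_singleton_add_one hx (M.set_finite Z hZE)
          omega
      · omega
    · rw [← hsub Z subset_rfl, ← hsub _ Set.sdiff_subset, hcy e he]
    · rintro rfl
      rw [Set.inter_self] at hi
      omega

lemma IsRelaxation.isCyclicFlat_of_ne [M.Finite] (h : M.IsRelaxation A P)
    (hA : M.IsStressedCuspidal A) (hco : ∀ e ∈ M.E, M.rk (M.E \ {e}) = M.rk M.E)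
    (hZ : M.IsCyclicFlat Z) (hne : Z ≠ A) : P.IsCyclicFlat Z := by
  have := h.finite
  have hk := h.rk_ground hA
  obtain ⟨hAE, hu, hc, hA1, hA2⟩ := isStressedCuspidal_iff_rk.1 hA
  obtain ⟨hZE, hfl, hcy⟩ := isCyclicFlat_iff_rk.1 hZ
  rcases lt_or_ge (M.rk A) (Z ∩ A).ncard with hi | hi
  -- Z ∩ A has more than rk A elements of A, so it spans A, and the flat Z absorbs A.
  · have hAZ : A ⊆ Z := fun e he ↦ by_contra fun heZ ↦ by
      have h1 := hfl e (hAE he) heZ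
      have h2 := hu (Z ∩ A) Set.inter_subset_right
      have h3 := M.rk_submod Z A
      have h4 := M.rk_mono (Set.insert_subset (Set.mem_union_right Z he) Set.subset_union_left)
      omega
    have hZe : Z = P.E :=
      (hZ.eq_ground_of_isStressedCuspidal_subset hA hAZ hne).trans h.2.1.symm
    subst hZe
    refine isCyclicFlat_ground fun e he ↦ (P.rk_mono Set.sdiff_subset).antisymm ?_
    rw [h.2.1] at he
    rw [hk, ← hco e he, h.2.1]
    exact h.rk_le hA Set.sdiff_subset
  · have hsub : ∀ X ⊆ Z, P.rk X = M.rk X := fun X hX ↦ by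
      have h1 := ncard_mono_ground (M := M) (Set.inter_subset_inter_left A hX)
        (Set.inter_subset_left.trans hZE)
      rw [h.rk_eq hA (hX.trans hZE), if_neg (by omega)]
    refine isCyclicFlat_iff_rk.2 ⟨h.2.1 ▸ hZE, fun e he heZ ↦ ?_, fun e he ↦ ?_⟩
    · rw [h.2.1] at he
      rw [hsub Z subset_rfl]
      exact (hfl e he heZ).trans_le (h.rk_le hA (Set.insert_subset he hZE))
    · rw [hsub Z subset_rfl, hsub _ Set.sdiff_subset, hcy e he]

lemma IsRelaxation.cyclicFlats_eq [M.Finite] (h : M.IsRelaxation A P)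
    (hA : M.IsStressedCuspidal A) (hl : ∀ e ∈ M.E, 0 < M.rk {e})
    (hco : ∀ e ∈ M.E, M.rk (M.E \ {e}) = M.rk M.E) :
    P.cyclicFlats = M.cyclicFlats \ {A} := by
  ext Z
  constructor
  · intro hZ
    obtain ⟨h1, h2, -⟩ := h.isCyclicFlat_of_isCyclicFlat hA hl hco hZ
    exact ⟨h1, h2⟩
  · rintro ⟨h1, h2⟩
    exact h.isCyclicFlat_of_ne hA hco h1 h2

lemma isUniform_iff_of_isBase_iff [M.Finite] (hE : N.E = M.E)
    (hb : ∀ B, N.IsBase B ↔ M.IsBase B ∨ ∃ A, M.IsStressedCuspidal A ∧ B ∈ M.cusp A) :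
    N.IsUniform ↔ ∀ S ⊆ M.E, S.ncard = M.rk M.E →
      M.IsBase S ∨ ∃ A, M.IsStressedCuspidal A ∧ S ∈ M.cusp A := by
  constructor
  · rintro ⟨k, hk⟩ S hS hSk
    -- Any base of M is also a base of N, which fixes the common size as rk M.
    obtain ⟨B, hB⟩ := M.exists_isBase
    have h1 := ((hk B).1 ((hb B).2 (.inl hB))).2
    rw [hB.encard_eq_eRank, ← rk_eq_eRank] at h1
    exact (hb S).1 ((hk S).2 ⟨hE ▸ hS, by rw [← h1, ← hSk, (M.set_finite S hS).cast_ncard_eq]⟩)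
  · refine fun h ↦ ⟨M.rk M.E, fun B ↦ ?_⟩
    rw [hb, rk_eq_eRank, hE]
    constructor
    · rintro (hB | ⟨A, -, hB⟩)
      · exact ⟨hB.subset_ground, hB.encard_eq_eRank⟩
      · exact ⟨hB.1, hB.2.1⟩
    · rintro ⟨hB, hBk⟩
      refine h B hB ?_
      rwa [← rk_eq_eRank, ← (M.set_finite B hB).cast_ncard_eq, Nat.cast_inj] at hBk

end CyclicFlats

end Matroid

/-! ### The theorem. -/

open Matroid

theorem theorem3p12 {α : Type*} (M : Matroid α) [M.Finite] :
    (∀ A : Set α, M.IsStressedCuspidal A → M.IsCyclicFlat A) ∧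
    (∃ N : Matroid α,
      N.E = M.E ∧
      (∀ B : Set α, N.IsBase B ↔
        M.IsBase B ∨ ∃ A : Set α, M.IsStressedCuspidal A ∧ B ∈ M.cusp A) ∧
      (∀ l : List (Set α), l.Nodup → (∀ A : Set α, A ∈ l ↔ M.IsStressedCuspidal A) →
        ∀ N' : Matroid α, M.RelaxesTo l N' ↔ N' = N) ∧
      (M.IsElementarySplit ↔ N.IsUniform)) ∧
    ((∀ e : α, ¬ M.IsLoop e) → (∀ e : α, ¬ M.IsColoop e) →
      ∀ (l : List (Set α)) (A : Set α) (N : Matroid α),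
        (l ++ [A]).Nodup → (∀ F ∈ l ++ [A], M.IsStressedCuspidal F) → M.RelaxesTo l N →
        N.CyclicFlatCovBy ∅ A ∧ N.CyclicFlatCovBy A N.E ∧
        ∃ P : Matroid α, N.IsRelaxation A P ∧
          P.cyclicFlats = N.cyclicFlats \ {A} ∧
          ∀ X ∈ P.cyclicFlats, P.eRk X = N.eRk X) := by
  refine ⟨fun A hA ↦ hA.isCyclicFlat, ?_, ?_⟩
  · have hfin : {A | M.IsStressedCuspidal A}.Finite :=
      M.ground_finite.finite_subsets.subset fun A hA ↦ hA.subset_ground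
    have hmem : ∀ A, A ∈ hfin.toFinset.toList ↔ M.IsStressedCuspidal A := fun A ↦ by simp
    obtain ⟨N, -, hNE, hNb, -⟩ := exists_relaxesTo (M := M) hfin.toFinset.toList
      (Finset.nodup_toList _) fun A hA ↦ (hmem A).1 hA
    simp only [hmem] at hNb
    refine ⟨N, hNE, hNb, fun l hl hlm N' ↦ ?_, ?_⟩
    · obtain ⟨N₁, hN₁, hE₁, hb₁, -⟩ := exists_relaxesTo (M := M) l hl fun A hA ↦ (hlm A).1 hA
      simp only [hlm] at hb₁
      have h1 : N₁ = N := ext_isBase (hE₁.trans hNE.symm) fun B _ ↦ by rw [hb₁, hNb]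
      subst h1
      exact ⟨fun h ↦ h.unique hN₁, fun h ↦ h ▸ hN₁⟩
    · rw [isElementarySplit_iff, isUniform_iff_of_isBase_iff hNE hNb, forall_isBase_or_mem_cusp_iff]
  · intro hloop hcoloop l A N hl hs hN
    rw [← List.concat_eq_append, List.nodup_concat] at hl
    have hA : M.IsStressedCuspidal A := hs A (by simp)
    obtain ⟨N₁, hN₁, hNE, -, hNs, hNr, hNk⟩ := exists_relaxesTo (M := M) l hl.2
      fun F hF ↦ hs F (by simp [hF])
    obtain rfl := hN.unique hN₁
    have hNfin : N.Finite := ⟨hNE ▸ M.ground_finite⟩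
    have hNA := hNs A hl.1 hA
    -- Relaxing never lowers a rank and keeps the total rank, so it creates neither loops nor
    -- coloops.
    have hlN : ∀ e ∈ N.E, 0 < N.rk {e} := fun e he ↦ by
      rw [hNE] at he
      refine lt_of_lt_of_le ?_ (hNr {e} (by simpa using he))
      have h1 : M.Indep {e} := indep_singleton.2 ((not_isLoop_iff he).1 (hloop e))
      rw [(indep_iff_rk.1 h1).2, Set.ncard_singleton]
      exact one_pos
    have hcN : ∀ e ∈ N.E, N.rk (N.E \ {e}) = N.rk N.E := fun e he ↦ by
      refine (N.rk_mono Set.sdiff_subset).antisymm ?_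
      rw [hNk, hNE]
      have h1 := mt (isColoop_iff_rk (hNE ▸ he)).2 (hcoloop e)
      have h2 := hNr (M.E \ {e}) Set.sdiff_subset
      omega
    obtain ⟨P, hP, -⟩ := hNA.exists_isRelaxation_rk
    have hPfin := hP.finite
    refine ⟨hNA.empty_covBy hlN, hNA.covBy_ground hcN, P, hP, hP.cyclicFlats_eq hNA hlN hcN,
      fun X hX ↦ ?_⟩
    rw [← coe_rk, ← coe_rk, (hP.isCyclicFlat_of_isCyclicFlat hNA hlN hcN hX).2.2]
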